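/- Let $k$ be a field, let $N$ be a free abelian group of finite rank, and let $\Sigma$ be a rational polyhedral fan in $N\otimes_{\mathbb Z}\mathbb Q$ whose toric variety $X$ is projective. Let $\rho_0,\dots,\rho_n$ be the rays of $\Sigma$, let $\operatorname{Cl}(X)$ be the divisor class group of $X$, and let $S=k[x_0,\dots,x_n]$ be the Cox ring, graded by letting $\deg(x_i)\in\operatorname{Cl}(X)$ be the class of the torus-invariant divisor of $\rho_i$. Let $B=\langle \prod_{\rho_i\not\subseteq\sigma}x_i : \sigma\in\Sigma\rangle$ be the irrelevant ideal, let $G=\operatorname{Hom}(\operatorname{Cl}(X),\mathbb G_m)$, and let $\mathcal X=[(\operatorname{Spec}S\setminus V(B))/G]$ be the associated projective toric stack. Let $\Delta\colon\mathcal X\to\mathcal X\times\mathcal X$ be the diagonal morphism and put $\mathcal O_\Delta=\Delta_*\mathcal O_{\mathcal X}$. Let $S'=k[x_0,\dots,x_n,y_0,\dots,y_n]$ be the Cox ring of $\mathcal X\times\mathcal X$, graded by $\operatorname{Cl}(X)\oplus\operatorname{Cl}(X)$ with $\deg(x_i)$ in the first summand and $\deg(y_i)=\deg(x_i)$ in the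 second. A graded $S'$-module $M$ has an associated quasi-coherent sheaf $\widetilde M$ on $\mathcal X\times\mathcal X$. Let $\operatorname{Eff}(X)\subseteq\operatorname{Cl}(X)$ be the subsemigroup (with $0$) generated by the classes $\deg(x_i)$, let $R=S'[\operatorname{Eff}(X)]$ be the semigroup ring, let $u_i\in R$ be the monomial corresponding to $\deg(x_i)\in\operatorname{Eff}(X)$, and grade $R$ by giving the monomial of $d\in\operatorname{Eff}(X)$ the degree $(-d,d)$. Let $F$ be the Koszul complex on the homogeneous elements $y_0-x_0u_0,\dots,y_n-x_nu_n$ of $R$, viewed as a complex of graded $S'$-modules. Then: 1. $F$ is acyclic, that is, $H_i(F)=0$ for all $i>0$. 2. Viewing $H_0(F)$ as a graded $S'$-module, $\widetilde{H_0(F)}\cong\mathcal O_\Delta$ as quasi-coherent sheaves on $\mathcal X\times\mathcal X$. In particular, the complex $\widetilde F$ of quasi-coherent sheaves on $\mathcal X\times\mathcal X$ is a resolution of $\mathcal O_\Delta$: there is a morphism $\widetilde{F_0}\to\mathcal O_\Delta$ for which the sequence $\cdots\to\widetilde{F_1}\to\widetilde{F_0}\to\mathcal O_\Delta\to 0$ is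 exact. -/

import Mathlib

open DirectSum TensorProduct

set_option linter.unusedSectionVars false

noncomputable section

namespace ToricStack

universe u v w w' w''

section Internal

variable {A : Type v} [DecidableEq A] {M : Type w} [AddCommGroup M]

theorem isInternal_of_sum {ℳ : A → AddSubgroup M} (hspan : ⨆ a, ℳ a = ⊤)
    (hind : ∀ (s : Finset A) (x : A → M), (∀ a, x a ∈ ℳ a) → ∑ a ∈ s, x a = 0 →
      ∀ a ∈ s, x a = 0) : DirectSum.IsInternal ℳ := by
  classical
  constructor
  · rw [injective_iff_map_eq_zero]
    intro z hz
    have h := hind (DFinsupp.support z) (fun a => (z a : M)) (fun a => (z a).2) (by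
      rw [DirectSum.coeAddMonoidHom_eq_dfinsuppSum] at hz
      simpa [DFinsupp.sum] using hz)
    refine DFinsupp.ext fun a => ?_
    by_cases ha : a ∈ DFinsupp.support z
    · exact Subtype.ext (h a ha)
    · simpa using ha
  · intro m
    have hm : m ∈ ⨆ a, ℳ a := hspan ▸ AddSubgroup.mem_top m
    induction hm using AddSubgroup.iSup_induction' with
    | hp a x hx => exact ⟨DirectSum.of (fun a => ℳ a) a ⟨x, hx⟩, by simp⟩
    | h1 => exact ⟨0, map_zero _⟩
    | hadd x y _ _ hx hy =>
      obtain ⟨p, rfl⟩ := hx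
      obtain ⟨q, rfl⟩ := hy
      exact ⟨p + q, map_add _ _ _⟩

theorem iSup_eq_top_of_isInternal {ℳ : A → AddSubgroup M} (h : DirectSum.IsInternal ℳ) :
    ⨆ a, ℳ a = ⊤ := by
  rw [eq_top_iff]
  intro m _
  obtain ⟨z, rfl⟩ := h.2 m
  induction z using DirectSum.induction_on with
  | zero => simp
  | of i x => simpa using AddSubgroup.mem_iSup_of_mem i x.2
  | add x y hx hy => rw [map_add]; exact add_mem (hx trivial) (hy trivial)

theorem eq_zero_of_sum_of_isInternal {ℳ : A → AddSubgroup M} (h : DirectSum.IsInternal ℳ)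
    {I : Type*} (s : Finset I) (σ : I → A) (hσ : Function.Injective σ) (x : I → M)
    (hx : ∀ i ∈ s, x i ∈ ℳ (σ i)) (h0 : ∑ i ∈ s, x i = 0) : ∀ i ∈ s, x i = 0 := by
  classical
  intro i hi
  have hz : (∑ i : s, DirectSum.of (fun a => ℳ a) (σ i) ⟨x i, hx i i.2⟩) = 0 := by
    apply h.1
    simpa [Finset.sum_attach s x] using h0
  have h1 := congrArg ((ℳ (σ i)).subtype.comp (DFinsupp.evalAddMonoidHom (σ i))) hz
  rw [map_sum, map_zero, Finset.sum_eq_single ⟨i, hi⟩] at h1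
  · have h2 := DirectSum.of_eq_same (β := fun a => ℳ a) (σ i) ⟨x i, hx i hi⟩
    exact (congrArg Subtype.val h2).symm.trans h1
  · intro j _ hj
    have h2 := DirectSum.of_eq_of_ne (β := fun a => ℳ a) (σ j) (σ i) ⟨x j, hx j j.2⟩
      (fun e => hj (Subtype.ext (hσ e).symm))
    exact congrArg Subtype.val h2
  · exact fun h => absurd (Finset.mem_univ _) h

end Internal

variable {k : Type u} [CommRing k] {A : Type v} [AddCommGroup A] [DecidableEq A]
  {T : Type u} [CommRing T] [Algebra k T]

/-- An `A`-graded module `M = ⨁ₐ Mₐ` over the `A`-graded ring `T = ⨁ₐ 𝒜ₐ`. -/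
structure GrMod (𝒜 : A → Submodule k T) where
  carrier : Type w
  [addCommGroup : AddCommGroup carrier]
  [module : Module T carrier]
  piece : A → AddSubgroup carrier
  isInternal : DirectSum.IsInternal piece
  smul_mem : ∀ {a b : A} {t : T} {m : carrier}, t ∈ 𝒜 a → m ∈ piece b → t • m ∈ piece (a + b)

attribute [instance] GrMod.addCommGroup GrMod.module

namespace GrMod

variable {𝒜 : A → Submodule k T}

/-- Homomorphisms of degree `0`. -/
structure Hom (M : GrMod.{u, v, w} 𝒜) (N : GrMod.{u, v, w'} 𝒜) where
  toLin : M.carrier →ₗ[T] N.carrier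
  map_mem : ∀ {a : A} {m : M.carrier}, m ∈ M.piece a → toLin m ∈ N.piece a

/-- The graded ring as a graded module over itself. -/
def self (𝒜 : A → Submodule k T) [GradedAlgebra 𝒜] : GrMod.{u, v, u} 𝒜 where
  carrier := T
  piece a := (𝒜 a).toAddSubgroup
  isInternal := DirectSum.Decomposition.isInternal 𝒜
  smul_mem ht hm := SetLike.mul_mem_graded ht hm

theorem exists_sum (M : GrMod.{u, v, w} 𝒜) (m : M.carrier) :
    ∃ (s : Finset A) (x : A → M.carrier), (∀ a, x a ∈ M.piece a) ∧ m = ∑ a ∈ s, x a := by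
  classical
  obtain ⟨z, rfl⟩ := M.isInternal.2 m
  refine ⟨DFinsupp.support z, fun a => (z a : M.carrier), fun a => (z a).2, ?_⟩
  rw [DirectSum.coeAddMonoidHom_eq_dfinsuppSum]
  simp [DFinsupp.sum]

/-- A homogeneous ring element acting injectively detects degrees. -/
theorem mem_of_smul_mem (M : GrMod.{u, v, w} 𝒜) {t : T} {b c : A} (ht : t ∈ 𝒜 b)
    (hinj : Function.Injective fun m : M.carrier => t • m) {m : M.carrier}
    (h : t • m ∈ M.piece (b + c)) : m ∈ M.piece c := by
  classical
  obtain ⟨s, x, hx, rfl⟩ := M.exists_sum m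
  have key := eq_zero_of_sum_of_isInternal M.isInternal (insert c s) (fun a => b + a)
    (fun a a' e => add_left_cancel e)
    (fun a => (if a ∈ s then t • x a else 0) - (if a = c then t • ∑ a ∈ s, x a else 0))
    (fun a _ => by
      refine sub_mem ?_ ?_
      · split_ifs
        · exact M.smul_mem ht (hx a)
        · exact zero_mem _
      · split_ifs with hac
        · subst hac; exact h
        · exact zero_mem _)
    (by
      rw [Finset.sum_sub_distrib, Finset.sum_ite_eq' (insert c s) c,
        if_pos (Finset.mem_insert_self _ _), ← Finset.sum_filter, Finset.smul_sum, sub_eq_zero]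
      refine Finset.sum_congr ?_ fun _ _ => rfl
      ext a; simp only [Finset.mem_filter, Finset.mem_insert]; tauto)
  refine sum_mem fun a ha => ?_
  by_cases hac : a = c
  · subst hac; exact hx a
  · have h1 := key a (Finset.mem_insert_of_mem ha)
    simp only [ha, hac, if_true, if_false, sub_zero] at h1
    have : x a = 0 := hinj (by simpa using h1)
    rw [this]; exact zero_mem _

theorem exists_homogeneous_preimage {M : GrMod.{u, v, w} 𝒜} {N : GrMod.{u, v, w'} 𝒜}
    (ψ : M.Hom N) {d : A} {m : M.carrier} (h : ψ.toLin m ∈ N.piece d) :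
    ∃ m' ∈ M.piece d, ψ.toLin m' = ψ.toLin m := by
  classical
  obtain ⟨s, x, hx, rfl⟩ := M.exists_sum m
  refine ⟨if d ∈ s then x d else 0, by split_ifs; exacts [hx d, zero_mem _], ?_⟩
  have key := eq_zero_of_sum_of_isInternal N.isInternal (insert d s) id Function.injective_id
    (fun a => (if a ∈ s then ψ.toLin (x a) else 0) -
      (if a = d then ψ.toLin (∑ a ∈ s, x a) else 0))
    (fun a _ => by
      refine sub_mem ?_ ?_
      · split_ifs
        · exact ψ.map_mem (hx a)
        · exact zero_mem _
      · split_ifs with hac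
        · subst hac; exact h
        · exact zero_mem _)
    (by
      rw [Finset.sum_sub_distrib, Finset.sum_ite_eq' (insert d s) d,
        if_pos (Finset.mem_insert_self _ _), ← Finset.sum_filter, map_sum, sub_eq_zero]
      refine Finset.sum_congr ?_ fun _ _ => rfl
      ext a; simp only [Finset.mem_filter, Finset.mem_insert]; tauto)
    d (Finset.mem_insert_self _ _)
  simp only [if_true, sub_eq_zero] at key
  rw [← key]
  split_ifs <;> simp

/-- The cokernel of a homomorphism of graded modules. -/
def coker {M : GrMod.{u, v, w} 𝒜} {N : GrMod.{u, v, w'} 𝒜} (φ : Hom M N) :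
    GrMod.{u, v, w'} 𝒜 where
  carrier := N.carrier ⧸ LinearMap.range φ.toLin
  piece a := (N.piece a).map (LinearMap.range φ.toLin).mkQ.toAddMonoidHom
  isInternal := by
    classical
    refine isInternal_of_sum ?_ ?_
    · rw [← AddSubgroup.map_iSup, iSup_eq_top_of_isInternal N.isInternal, eq_top_iff]
      intro z _
      obtain ⟨n, rfl⟩ := Submodule.mkQ_surjective _ z
      exact ⟨n, trivial, rfl⟩
    · intro s x hx h0
      choose y hy hyx using hx
      have h1 : (LinearMap.range φ.toLin).mkQ (∑ a ∈ s, y a) = 0 := by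
        rw [map_sum, ← h0]
        exact Finset.sum_congr rfl fun a _ => hyx a
      rw [Submodule.mkQ_apply, Submodule.Quotient.mk_eq_zero] at h1
      obtain ⟨m, hm⟩ := h1
      obtain ⟨s', z, hz, rfl⟩ := M.exists_sum m
      have key := eq_zero_of_sum_of_isInternal N.isInternal (s ∪ s') id
        Function.injective_id
        (fun a => (if a ∈ s then y a else 0) - (if a ∈ s' then φ.toLin (z a) else 0))
        (fun a _ => by
          refine sub_mem ?_ ?_
          · split_ifs
            · exact hy a
            · exact zero_mem _
          · split_ifs
            · exact φ.map_mem (hz a)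
            · exact zero_mem _)
        (by
          rw [Finset.sum_sub_distrib, ← Finset.sum_filter, ← Finset.sum_filter, sub_eq_zero,
            Finset.filter_mem_eq_inter, Finset.filter_mem_eq_inter,
            Finset.inter_eq_right.2 Finset.subset_union_left,
            Finset.inter_eq_right.2 Finset.subset_union_right, ← hm, map_sum])
      intro a ha
      have h2 := key a (Finset.mem_union_left _ ha)
      simp only [ha, if_true, sub_eq_zero] at h2
      rw [← hyx a, h2]
      change (LinearMap.range φ.toLin).mkQ _ = 0
      rw [Submodule.mkQ_apply, Submodule.Quotient.mk_eq_zero]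
      split_ifs
      · exact ⟨_, rfl⟩
      · exact zero_mem _
  smul_mem := by
    rintro a b t _ ht ⟨n, hn, rfl⟩
    exact ⟨t • n, N.smul_mem ht hn, map_smul (LinearMap.range φ.toLin).mkQ t n⟩

end GrMod

/-- The open substack `[D(f)/H]` of `[(Spec T ∖ V(B))/H]`, where `H = Hom(A, 𝔾ₘ)` is the
diagonalizable group with character group `A` that acts on `Spec T` through the grading of `T`,
and `f` is homogeneous with `D(f) ⊆ Spec T ∖ V(B)`. -/
structure Chart (𝒜 : A → Submodule k T) (B : Ideal T) where
  f : T
  homog : ∃ a, f ∈ 𝒜 a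
  mem : f ∈ B.radical

/-- `V ≤ U` means `D(V.f) ⊆ D(U.f)`. -/
instance (𝒜 : A → Submodule k T) (B : Ideal T) : Preorder (Chart 𝒜 B) where
  le V U := ∃ n : ℕ, U.f ∣ V.f ^ n
  le_refl U := ⟨1, by simp⟩
  le_trans W V U := by
    rintro ⟨n, hn⟩ ⟨m, hm⟩
    exact ⟨n * m, hm.trans (by rw [pow_mul]; exact pow_dvd_pow_of_dvd hn m)⟩

/-- Quasi-coherent sheaves on the quotient stack `𝒴 = [(Spec T ∖ V(B))/H]`, `H = Hom(A, 𝔾ₘ)`,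
given on the basis of open substacks `[D(f)/H]`.
A quasi-coherent sheaf on `[D(f)/H]` is an `H`-equivariant quasi-coherent sheaf on the affine
scheme `D(f)`, that is, an `A`-graded module over the localization `T_f`; here it is recorded as a
graded `T`-module `sec U` on which `f` acts invertibly (which is the case `U = V` of
`isLocalized`).  Its degree `a` piece is `Γ([D(f)/H], 𝓕(a))`.  For `D(g) ⊆ D(f)`, restriction
identifies the module over `T_g` with the localization at `g` of the module over `T_f`. -/
structure QCoh (𝒜 : A → Submodule k T) (B : Ideal T) where
  sec : Chart 𝒜 B → GrMod.{u, v, w} 𝒜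
  res : ∀ {U V : Chart 𝒜 B}, V ≤ U → (sec U).Hom (sec V)
  res_refl : ∀ (U : Chart 𝒜 B) (x : (sec U).carrier), (res (le_refl U)).toLin x = x
  res_trans : ∀ {U V W : Chart 𝒜 B} (h₁ : V ≤ U) (h₂ : W ≤ V) (x : (sec U).carrier),
    (res h₂).toLin ((res h₁).toLin x) = (res (h₂.trans h₁)).toLin x
  isLocalized : ∀ {U V : Chart 𝒜 B} (h : V ≤ U),
    IsLocalizedModule (Submonoid.powers V.f) (res h).toLin

namespace QCoh

variable {𝒜 : A → Submodule k T} {B : Ideal T}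

/-- Morphisms of quasi-coherent sheaves. -/
structure Hom (F : QCoh.{u, v, w} 𝒜 B) (G : QCoh.{u, v, w'} 𝒜 B) where
  app : ∀ U : Chart 𝒜 B, (F.sec U).Hom (G.sec U)
  naturality : ∀ {U V : Chart 𝒜 B} (h : V ≤ U) (x : (F.sec U).carrier),
    (app V).toLin ((F.res h).toLin x) = (G.res h).toLin ((app U).toLin x)

/-- Isomorphisms of quasi-coherent sheaves. -/
structure Iso (F : QCoh.{u, v, w} 𝒜 B) (G : QCoh.{u, v, w'} 𝒜 B) where
  hom : Hom F G
  inv : Hom G F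
  hom_inv : ∀ (U : Chart 𝒜 B) (x : (F.sec U).carrier),
    (inv.app U).toLin ((hom.app U).toLin x) = x
  inv_hom : ∀ (U : Chart 𝒜 B) (y : (G.sec U).carrier),
    (hom.app U).toLin ((inv.app U).toLin y) = y

/-- Exactness of `F → G → H` at `G`.  Kernels and images of morphisms of quasi-coherent sheaves
are formed on the affine charts. -/
def Exact {F : QCoh.{u, v, w} 𝒜 B} {G : QCoh.{u, v, w'} 𝒜 B} {H : QCoh.{u, v, w''} 𝒜 B}
    (φ : Hom F G) (ψ : Hom G H) : Prop :=
  ∀ U : Chart 𝒜 B, Function.Exact (φ.app U).toLin (ψ.app U).toLin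

/-- Epimorphisms of quasi-coherent sheaves. -/
def Epi {F : QCoh.{u, v, w} 𝒜 B} {G : QCoh.{u, v, w'} 𝒜 B} (φ : Hom F G) : Prop :=
  ∀ U : Chart 𝒜 B, Function.Surjective (φ.app U).toLin

end QCoh

section Sheafify

variable {𝒜 : A → Submodule k T} {B : Ideal T}

/-- The localization `M_f` of a graded module at a homogeneous element: the piece of degree `a`
consists of the fractions `m / s` with `s` a power of `f` that is homogeneous of some degree `c`
and `m` homogeneous of degree `a + c`. -/
def GrMod.away [GradedAlgebra 𝒜] (M : GrMod.{u, v, w} 𝒜) (f : T) (hf : ∃ a, f ∈ 𝒜 a) :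
    GrMod.{u, v, max u w} 𝒜 where
  carrier := LocalizedModule (Submonoid.powers f) M.carrier
  piece a :=
    { carrier := {z | ∃ (c : A) (s : Submonoid.powers f) (m : M.carrier),
        (s : T) ∈ 𝒜 c ∧ m ∈ M.piece (a + c) ∧ z = LocalizedModule.mk m s}
      zero_mem' := ⟨0, 1, 0, SetLike.GradedOne.one_mem, zero_mem _,
        (LocalizedModule.zero_mk _).symm⟩
      add_mem' := by
        rintro _ _ ⟨c, s, m, hs, hm, rfl⟩ ⟨c', s', m', hs', hm', rfl⟩
        refine ⟨c + c', s * s', s' • m + s • m', SetLike.mul_mem_graded hs hs', ?_,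
          LocalizedModule.mk_add_mk⟩
        refine add_mem ?_ ?_
        · rw [show a + (c + c') = c' + (a + c) by abel]
          exact M.smul_mem hs' hm
        · rw [show a + (c + c') = c + (a + c') by abel]
          exact M.smul_mem hs hm'
      neg_mem' := by
        rintro _ ⟨c, s, m, hs, hm, rfl⟩
        exact ⟨c, s, -m, hs, neg_mem hm, LocalizedModule.mk_neg.symm⟩ }
  isInternal := by
    classical
    obtain ⟨b, hb⟩ := hf
    have hs : ∀ s : Submonoid.powers f, ∃ c, (s : T) ∈ 𝒜 c := by
      rintro ⟨_, n, rfl⟩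
      exact ⟨n • b, SetLike.pow_mem_graded n hb⟩
    have mk_add : ∀ (s : Submonoid.powers f) (m m' : M.carrier), LocalizedModule.mk (m + m') s =
        LocalizedModule.mk m s + LocalizedModule.mk m' s := by
      intro s m m'
      rw [LocalizedModule.mk_add_mk, ← smul_add, LocalizedModule.mk_cancel_common_left]
    let mkHom (s : Submonoid.powers f) :
        M.carrier →+ LocalizedModule (Submonoid.powers f) M.carrier :=
      AddMonoidHom.mk' (fun m => LocalizedModule.mk m s) (mk_add s)
    refine isInternal_of_sum ?_ ?_
    · rw [eq_top_iff]
      intro z _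
      induction z using LocalizedModule.induction_on with
      | h m s =>
        obtain ⟨c, hc⟩ := hs s
        obtain ⟨t, x, hx, rfl⟩ := M.exists_sum m
        have : LocalizedModule.mk (∑ a ∈ t, x a) s =
            ∑ a ∈ t, LocalizedModule.mk (x a) s := by
          exact map_sum (mkHom s) x t
        rw [this]
        refine sum_mem fun a _ => AddSubgroup.mem_iSup_of_mem (a - c) ?_
        exact ⟨c, s, x a, hc, by simpa using hx a, rfl⟩
    · intro s x hx h0
      choose c d m hd hm hx using hx
      have hD : ∀ a ∈ s, (∏ i ∈ s, d i) • x a =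
          LocalizedModule.mk ((∏ i ∈ s.erase a, d i) • m a) 1 := by
        intro a ha
        rw [hx a, ← Finset.mul_prod_erase s d ha, Submonoid.smul_def, LocalizedModule.smul'_mk,
          ← Submonoid.smul_def, mul_smul, LocalizedModule.mk_cancel]
      have h1 : LocalizedModule.mk (∑ a ∈ s, (∏ i ∈ s.erase a, d i) • m a) 1 =
          (0 : LocalizedModule (Submonoid.powers f) M.carrier) := by
        have h2 := congrArg (fun z => (∏ i ∈ s, d i) • z) h0
        simp only [Finset.smul_sum, smul_zero] at h2
        rw [Finset.sum_congr rfl hD] at h2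
        rw [← h2]
        exact map_sum (mkHom 1) _ s
      rw [← LocalizedModule.zero_mk 1, LocalizedModule.mk_eq] at h1
      obtain ⟨t, ht⟩ := h1
      simp only [one_smul, smul_zero, Finset.smul_sum] at ht
      obtain ⟨e, he⟩ := hs t
      have key := eq_zero_of_sum_of_isInternal M.isInternal s
        (fun a => e + (a + ∑ i ∈ s, c i))
        (fun a a' h => add_right_cancel (add_left_cancel h)) _
        (fun a ha => by
          refine M.smul_mem he ?_
          rw [show a + ∑ i ∈ s, c i = ∑ i ∈ s.erase a, c i + (a + c a) by
            rw [← Finset.add_sum_erase s c ha]; abel]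
          refine M.smul_mem ?_ (hm a)
          rw [Submonoid.coe_finsetProd]
          exact SetLike.prod_mem_graded 𝒜 c (fun i => (d i : T)) fun i _ => hd i) ht
      intro a ha
      rw [hx a, ← LocalizedModule.zero_mk 1, LocalizedModule.mk_eq]
      refine ⟨t * ∏ i ∈ s.erase a, d i, ?_⟩
      rw [one_smul, smul_zero, smul_zero, mul_smul]
      exact key a ha
  smul_mem := by
    rintro a b t _ ht ⟨c, s, m, hs, hm, rfl⟩
    refine ⟨c, s, t • m, hs, ?_, by rw [LocalizedModule.smul'_mk]⟩
    rw [add_assoc]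
    exact M.smul_mem ht hm


theorem isUnit_end_of_dvd {M : Type w} [AddCommGroup M] [Module T M] {s t : T} (h : s ∣ t)
    (ht : IsUnit (algebraMap T (Module.End T M) t)) :
    IsUnit (algebraMap T (Module.End T M) s) := by
  obtain ⟨r, rfl⟩ := h
  rw [map_mul] at ht
  have hc : Commute (algebraMap T (Module.End T M) s) (algebraMap T (Module.End T M) r) :=
    Algebra.commutes s _
  exact (hc.isUnit_mul_iff.1 ht).1

theorem isUnit_away_of_le {U V : Chart 𝒜 B} (h : V ≤ U) (M : Type w) [AddCommGroup M]
    [Module T M] (s : Submonoid.powers U.f) :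
    IsUnit (algebraMap T (Module.End T (LocalizedModule (Submonoid.powers V.f) M)) s) := by
  obtain ⟨n, hn⟩ := h
  obtain ⟨_, i, rfl⟩ := s
  refine isUnit_end_of_dvd (t := (V.f ^ n) ^ i) (pow_dvd_pow_of_dvd hn i) ?_
  rw [← pow_mul]
  exact IsLocalizedModule.map_units
    (LocalizedModule.mkLinearMap (Submonoid.powers V.f) M)
    (⟨V.f ^ (n * i), n * i, rfl⟩ : Submonoid.powers V.f)

/-- The restriction map `M_f → M_g` for `D(g) ⊆ D(f)`. -/
def awayRes {U V : Chart 𝒜 B} (h : V ≤ U) (M : Type w) [AddCommGroup M] [Module T M] :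
    LocalizedModule (Submonoid.powers U.f) M →ₗ[T] LocalizedModule (Submonoid.powers V.f) M :=
  LocalizedModule.lift (Submonoid.powers U.f)
    (LocalizedModule.mkLinearMap (Submonoid.powers V.f) M) (isUnit_away_of_le h M)

theorem awayRes_mk_one {U V : Chart 𝒜 B} (h : V ≤ U) (M : Type w) [AddCommGroup M] [Module T M]
    (m : M) : awayRes h M (LocalizedModule.mk m 1) = LocalizedModule.mk m 1 := by
  simp [awayRes, LocalizedModule.lift_mk_one]

theorem smul_mk_self {f : T} (M : Type w) [AddCommGroup M] [Module T M] (m : M)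
    (s : Submonoid.powers f) : (s : T) • LocalizedModule.mk m s = LocalizedModule.mk m 1 := by
  rw [LocalizedModule.smul'_mk, ← Submonoid.smul_def, LocalizedModule.mk_cancel]

theorem smul_inj_of_isUnit {M : Type w} [AddCommGroup M] [Module T M] {s : T}
    (hs : IsUnit (algebraMap T (Module.End T M) s)) :
    Function.Injective fun m : M => s • m :=
  ((Module.End.isUnit_iff _).1 hs).1

theorem awayRes_smul_mk {U V : Chart 𝒜 B} (h : V ≤ U) (M : Type w) [AddCommGroup M] [Module T M]
    (m : M) (s : Submonoid.powers U.f) :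
    (s : T) • awayRes h M (LocalizedModule.mk m s) = LocalizedModule.mk m 1 := by
  rw [← map_smul, smul_mk_self, awayRes_mk_one]

theorem awayRes_refl (U : Chart 𝒜 B) (M : Type w) [AddCommGroup M] [Module T M]
    (x : LocalizedModule (Submonoid.powers U.f) M) : awayRes (le_refl U) M x = x := by
  induction x using LocalizedModule.induction_on with
  | h m s =>
    refine smul_inj_of_isUnit (isUnit_away_of_le (le_refl U) M s) ?_
    change (s : T) • _ = (s : T) • _
    rw [awayRes_smul_mk, smul_mk_self]

theorem awayRes_trans {U V W : Chart 𝒜 B} (h₁ : V ≤ U) (h₂ : W ≤ V) (M : Type w)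
    [AddCommGroup M] [Module T M] (x : LocalizedModule (Submonoid.powers U.f) M) :
    awayRes h₂ M (awayRes h₁ M x) = awayRes (h₂.trans h₁) M x := by
  induction x using LocalizedModule.induction_on with
  | h m s =>
    refine smul_inj_of_isUnit (isUnit_away_of_le (h₂.trans h₁) M s) ?_
    change (s : T) • _ = (s : T) • _
    rw [← map_smul, awayRes_smul_mk, awayRes_smul_mk, awayRes_mk_one]

theorem awayRes_isLocalized {U V : Chart 𝒜 B} (h : V ≤ U) (M : Type w)
    [AddCommGroup M] [Module T M] :
    IsLocalizedModule (Submonoid.powers V.f) (awayRes h M) where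
  map_units s := isUnit_away_of_le (le_refl V) M s
  surj y := by
    induction y using LocalizedModule.induction_on with
    | h m s =>
      exact ⟨(LocalizedModule.mk m 1, s), (smul_mk_self M m s).trans (awayRes_mk_one h M m).symm⟩
  exists_of_eq {x y} hxy := by
    induction x using LocalizedModule.induction_on with
    | h m s =>
    induction y using LocalizedModule.induction_on with
    | h n t =>
      have h1 : LocalizedModule.mk ((t : T) • m) (1 : Submonoid.powers V.f) =
          LocalizedModule.mk ((s : T) • n) 1 := by
        have h2 : (t : T) • (s : T) • awayRes h M (LocalizedModule.mk m s) =
            (s : T) • (t : T) • awayRes h M (LocalizedModule.mk n t) := by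
          rw [hxy, smul_comm]
        rwa [awayRes_smul_mk, awayRes_smul_mk, LocalizedModule.smul'_mk,
          LocalizedModule.smul'_mk] at h2
      obtain ⟨c, hc⟩ := LocalizedModule.mk_eq.1 h1
      simp only [one_smul] at hc
      refine ⟨c, smul_inj_of_isUnit (isUnit_away_of_le (le_refl U) M (s * t)) ?_⟩
      have h3 : (c : T) • (t : T) • (s : T) • (LocalizedModule.mk m s) =
          (c : T) • (s : T) • (t : T) • LocalizedModule.mk n t := by
        rw [smul_mk_self, smul_mk_self, LocalizedModule.smul'_mk,
          LocalizedModule.smul'_mk, LocalizedModule.smul'_mk, LocalizedModule.smul'_mk]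
        exact congrArg (fun z => LocalizedModule.mk z 1) hc
      simp only [smul_smul] at h3
      change ((s : T) * (t : T)) • (c : T) • LocalizedModule.mk m s =
        ((s : T) * (t : T)) • (c : T) • LocalizedModule.mk n t
      simp only [smul_smul]
      convert h3 using 2 <;> ring

/-- The sheafification `M~` of a graded module `M`: on `[D(f)/H]` it is the graded module `M_f`. -/
def sheafify [GradedAlgebra 𝒜] (B : Ideal T) (M : GrMod.{u, v, w} 𝒜) :
    QCoh.{u, v, max u w} 𝒜 B where
  sec U := M.away U.f U.homog
  res {U V} h :=
    { toLin := awayRes h M.carrier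
      map_mem := by
        rintro a _ ⟨c, s, m, hs, hm, rfl⟩
        refine GrMod.mem_of_smul_mem (M.away V.f V.homog) hs
          (smul_inj_of_isUnit (isUnit_away_of_le h M.carrier s)) ?_
        exact ⟨0, 1, m, SetLike.GradedOne.one_mem, by rwa [add_zero, add_comm],
          awayRes_smul_mk h M.carrier m s⟩ }
  res_refl U x := awayRes_refl U M.carrier x
  res_trans h₁ h₂ x := awayRes_trans h₁ h₂ M.carrier x
  isLocalized h := awayRes_isLocalized h M.carrier

/-- The map `M_f → N_f` induced by a linear map `M → N`. -/
def awayMap (f : T) {M : Type w} [AddCommGroup M] [Module T M] {N : Type w'} [AddCommGroup N]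
    [Module T N] (φ : M →ₗ[T] N) :
    LocalizedModule (Submonoid.powers f) M →ₗ[T] LocalizedModule (Submonoid.powers f) N :=
  IsLocalizedModule.map (Submonoid.powers f)
    (LocalizedModule.mkLinearMap (Submonoid.powers f) M)
    (LocalizedModule.mkLinearMap (Submonoid.powers f) N) φ

theorem awayMap_mk (f : T) {M : Type w} [AddCommGroup M] [Module T M] {N : Type w'}
    [AddCommGroup N] [Module T N] (φ : M →ₗ[T] N) (m : M) (s : Submonoid.powers f) :
    awayMap f φ (LocalizedModule.mk m s) = LocalizedModule.mk (φ m) s :=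
  IsLocalizedModule.map_LocalizedModules _ _ _ _

theorem awayMap_awayRes {U V : Chart 𝒜 B} (h : V ≤ U) {M : Type w} [AddCommGroup M]
    [Module T M] {N : Type w'} [AddCommGroup N] [Module T N] (φ : M →ₗ[T] N)
    (x : LocalizedModule (Submonoid.powers U.f) M) :
    awayMap V.f φ (awayRes h M x) = awayRes h N (awayMap U.f φ x) := by
  induction x using LocalizedModule.induction_on with
  | h m s =>
    refine smul_inj_of_isUnit (isUnit_away_of_le h N s) ?_
    change (s : T) • _ = (s : T) • _
    rw [← map_smul, awayRes_smul_mk, awayMap_mk, awayMap_mk, awayRes_smul_mk]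

/-- Sheafification of homomorphisms. -/
def sheafifyMap [GradedAlgebra 𝒜] (B : Ideal T) {M : GrMod.{u, v, w} 𝒜}
    {N : GrMod.{u, v, w'} 𝒜} (φ : M.Hom N) : (sheafify B M).Hom (sheafify B N) where
  app U :=
    { toLin := awayMap U.f φ.toLin
      map_mem := by
        rintro a _ ⟨c, s, m, hs, hm, rfl⟩
        exact ⟨c, s, φ.toLin m, hs, φ.map_mem hm, awayMap_mk U.f φ.toLin m s⟩ }
  naturality h x := awayMap_awayRes h φ.toLin x

/-- The structure sheaf. -/
def structureSheaf (𝒜 : A → Submodule k T) [GradedAlgebra 𝒜] (B : Ideal T) :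
    QCoh.{u, v, u} 𝒜 B :=
  sheafify B (GrMod.self 𝒜)

end Sheafify

section Pushforward

variable {A' : Type v} [AddCommGroup A'] [DecidableEq A'] {T' : Type u} [CommRing T'] [Algebra k T']

/-- An affine morphism `[(Spec T' ∖ V(B'))/H'] → [(Spec T ∖ V(B))/H]` induced by a ring
homomorphism `T → T'` that is compatible with the group homomorphism `H' → H` dual to
`deg : A → A'`, and such that `Spec T' ∖ V(B')` is the preimage of `Spec T ∖ V(B)`. -/
structure Mor (𝒜' : A' → Submodule k T') (B' : Ideal T') (𝒜 : A → Submodule k T)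
    (B : Ideal T) where
  ring : T →ₐ[k] T'
  deg : A →+ A'
  map_mem : ∀ {a : A} {t : T}, t ∈ 𝒜 a → ring t ∈ 𝒜' (deg a)
  radical_map : (B.map ring).radical = B'.radical

variable {𝒜' : A' → Submodule k T'} {B' : Ideal T'} {𝒜 : A → Submodule k T} {B : Ideal T}

namespace Mor

/-- The preimage of the open substack `[D(f)/H]` is `[D(ring f)/H']`. -/
def preimage (φ : Mor 𝒜' B' 𝒜 B) (U : Chart 𝒜 B) : Chart 𝒜' B' where
  f := φ.ring U.f
  homog := U.homog.imp' φ.deg fun _ h => φ.map_mem h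
  mem := by
    rw [← φ.radical_map]
    obtain ⟨n, hn⟩ := U.mem
    exact ⟨n, by rw [← map_pow]; exact Ideal.mem_map_of_mem _ hn⟩

theorem preimage_mono (φ : Mor 𝒜' B' 𝒜 B) {U V : Chart 𝒜 B} (h : V ≤ U) :
    φ.preimage V ≤ φ.preimage U := by
  obtain ⟨n, hn⟩ := h
  exact ⟨n, by simpa [preimage] using map_dvd φ.ring hn⟩

variable [GradedAlgebra 𝒜]

/-- The pieces of the push-forward: `Γ(U, (φ_* N)(a)) = Γ(φ⁻¹ U, N(deg a))`. -/
abbrev PushPiece (φ : Mor 𝒜' B' 𝒜 B) (N : GrMod.{u, v, w} 𝒜') (a : A) : Type w :=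
  N.piece (φ.deg a)

theorem pushPiece_ext (φ : Mor 𝒜' B' 𝒜 B) (N : GrMod.{u, v, w} 𝒜') {i j : A} (h : i = j)
    {x : φ.PushPiece N i} {y : φ.PushPiece N j} (e : (x : N.carrier) = y) :
    (⟨i, x⟩ : GradedMonoid (φ.PushPiece N)) = ⟨j, y⟩ := by
  subst h
  exact congrArg _ (Subtype.ext e)

instance pushGmodule (φ : Mor 𝒜' B' 𝒜 B) (N : GrMod.{u, v, w} 𝒜') :
    DirectSum.Gmodule (fun a => 𝒜 a) (φ.PushPiece N) where
  smul {i j} t n := ⟨φ.ring t • (n : N.carrier), by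
    rw [vadd_eq_add, map_add]
    exact N.smul_mem (φ.map_mem t.2) n.2⟩
  one_smul := by
    rintro ⟨i, n⟩
    refine φ.pushPiece_ext N (zero_add i) ?_
    change φ.ring 1 • (n : N.carrier) = n
    simp
  mul_smul := by
    rintro ⟨i, s⟩ ⟨j, t⟩ ⟨l, n⟩
    refine φ.pushPiece_ext N (add_assoc i j l) ?_
    change φ.ring (s * t) • (n : N.carrier) = φ.ring s • φ.ring t • (n : N.carrier)
    simp [mul_smul]
  smul_add _ _ _ := Subtype.ext (smul_add _ _ _)
  smul_zero _ := Subtype.ext (smul_zero _)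
  add_smul _ _ _ := Subtype.ext (by
    change φ.ring _ • _ = φ.ring _ • _ + φ.ring _ • _
    simp [add_smul])
  zero_smul _ := Subtype.ext (by
    change φ.ring _ • _ = 0
    simp)

/-- The underlying module `⨁ₐ N_{deg a}` of the push-forward. -/
def PushType (φ : Mor 𝒜' B' 𝒜 B) (N : GrMod.{u, v, w} 𝒜') : Type (max v w) :=
  ⨁ a, φ.PushPiece N a

instance (φ : Mor 𝒜' B' 𝒜 B) (N : GrMod.{u, v, w} 𝒜') : AddCommGroup (φ.PushType N) :=
  inferInstanceAs (AddCommGroup (⨁ a, φ.PushPiece N a))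

/-- A homogeneous `t ∈ T` of degree `b` sends `n ∈ N_{deg a}` to `ring t • n ∈ N_{deg (b + a)}`. -/
instance (φ : Mor 𝒜' B' 𝒜 B) (N : GrMod.{u, v, w} 𝒜') : Module T (φ.PushType N) :=
  Module.compHom (⨁ a, φ.PushPiece N a) (DirectSum.decomposeRingEquiv 𝒜 : T →+* ⨁ a, 𝒜 a)

/-- The inclusion of the degree `a` piece. -/
def pushOf (φ : Mor 𝒜' B' 𝒜 B) (N : GrMod.{u, v, w} 𝒜') (a : A) :
    N.piece (φ.deg a) →+ φ.PushType N :=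
  DirectSum.of (φ.PushPiece N) a

/-- The projection to the degree `a` piece. -/
def pushProj (φ : Mor 𝒜' B' 𝒜 B) (N : GrMod.{u, v, w} 𝒜') (a : A) :
    φ.PushType N →+ N.piece (φ.deg a) :=
  DFinsupp.evalAddMonoidHom (β := φ.PushPiece N) a

theorem pushProj_pushOf (φ : Mor 𝒜' B' 𝒜 B) (N : GrMod.{u, v, w} 𝒜') (a : A)
    (n : N.piece (φ.deg a)) : φ.pushProj N a (φ.pushOf N a n) = n :=
  DirectSum.of_eq_same (β := φ.PushPiece N) a n

theorem pushProj_pushOf_ne (φ : Mor 𝒜' B' 𝒜 B) (N : GrMod.{u, v, w} 𝒜') {a b : A} (h : a ≠ b)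
    (n : N.piece (φ.deg a)) : φ.pushProj N b (φ.pushOf N a n) = 0 :=
  DirectSum.of_eq_of_ne (β := φ.PushPiece N) a b n h.symm

theorem push_induction (φ : Mor 𝒜' B' 𝒜 B) (N : GrMod.{u, v, w} 𝒜') {p : φ.PushType N → Prop}
    (x : φ.PushType N) (zero : p 0) (of : ∀ a n, p (φ.pushOf N a n))
    (add : ∀ x y, p x → p y → p (x + y)) : p x :=
  DirectSum.induction_on x zero of add

theorem push_ext (φ : Mor 𝒜' B' 𝒜 B) (N : GrMod.{u, v, w} 𝒜') {x y : φ.PushType N}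
    (h : ∀ a, φ.pushProj N a x = φ.pushProj N a y) : x = y :=
  DFinsupp.ext h

theorem pushOf_congr (φ : Mor 𝒜' B' 𝒜 B) (N : GrMod.{u, v, w} 𝒜') {a b : A} (h : a = b)
    {n : N.piece (φ.deg a)} {m : N.piece (φ.deg b)} (e : (n : N.carrier) = m) :
    φ.pushOf N a n = φ.pushOf N b m := by
  subst h
  exact congrArg _ (Subtype.ext e)

theorem smul_pushOf (φ : Mor 𝒜' B' 𝒜 B) (N : GrMod.{u, v, w} 𝒜') {a b : A} {t : T}
    (ht : t ∈ 𝒜 b) (n : N.piece (φ.deg a)) (h : φ.ring t • (n : N.carrier) ∈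
      N.piece (φ.deg (b + a))) :
    t • φ.pushOf N a n = φ.pushOf N (b + a) ⟨φ.ring t • (n : N.carrier), h⟩ := by
  change (DirectSum.decompose 𝒜 t) • (DirectSum.of (φ.PushPiece N) a n) = _
  rw [DirectSum.decompose_of_mem 𝒜 ht, DirectSum.Gmodule.of_smul_of]
  rfl

theorem smul_pushOf_mem (φ : Mor 𝒜' B' 𝒜 B) (N : GrMod.{u, v, w} 𝒜') {a b : A} {t : T}
    (ht : t ∈ 𝒜 b) (n : N.piece (φ.deg a)) :
    φ.ring t • (n : N.carrier) ∈ N.piece (φ.deg (b + a)) := by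
  rw [map_add]
  exact N.smul_mem (φ.map_mem ht) n.2

theorem pushProj_smul (φ : Mor 𝒜' B' 𝒜 B) (N : GrMod.{u, v, w} 𝒜') {a b : A} {t : T}
    (ht : t ∈ 𝒜 b) (x : φ.PushType N) :
    (φ.pushProj N (b + a) (t • x) : N.carrier) = φ.ring t • (φ.pushProj N a x : N.carrier) := by
  induction x using φ.push_induction N with
  | zero => simp
  | add x y hx hy => simp [smul_add, hx, hy]
  | of c n =>
    rw [φ.smul_pushOf N ht n (φ.smul_pushOf_mem N ht n)]
    by_cases hc : c = a
    · subst hc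
      rw [pushProj_pushOf, pushProj_pushOf]
    · rw [pushProj_pushOf_ne φ N (fun e => hc (add_left_cancel e)), pushProj_pushOf_ne φ N hc]
      simp

/-- The push-forward of a graded module: `(φ_* N)_a = N_{deg a}`. -/
def push (φ : Mor 𝒜' B' 𝒜 B) (N : GrMod.{u, v, w} 𝒜') : GrMod.{u, v, max v w} 𝒜 where
  carrier := φ.PushType N
  piece a := (φ.pushOf N a).range
  isInternal := by
    refine isInternal_of_sum ?_ ?_
    · rw [eq_top_iff]
      intro x _
      induction x using φ.push_induction N with
      | zero => exact zero_mem _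
      | of a n => exact AddSubgroup.mem_iSup_of_mem a ⟨n, rfl⟩
      | add x y hx hy => exact add_mem (hx trivial) (hy trivial)
    · intro s x hx h0 a ha
      choose y hy using hx
      have h1 := congrArg (φ.pushProj N a) h0
      rw [map_sum, map_zero, Finset.sum_eq_single a] at h1
      · rw [← hy a, pushProj_pushOf] at h1
        rw [← hy a, h1, map_zero]
      · intro b _ hb
        rw [← hy b, pushProj_pushOf_ne φ N hb]
      · exact fun h => absurd ha h
  smul_mem := by
    rintro a b t _ ht ⟨n, rfl⟩
    exact ⟨_, (φ.smul_pushOf N ht n (φ.smul_pushOf_mem N ht n)).symm⟩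

/-- The map on push-forwards induced by a homomorphism of graded modules. -/
def pushMapAdd (φ : Mor 𝒜' B' 𝒜 B) {M : GrMod.{u, v, w} 𝒜'} {N : GrMod.{u, v, w'} 𝒜'}
    (ψ : M.Hom N) : φ.PushType M →+ φ.PushType N :=
  DirectSum.toAddMonoid (β := φ.PushPiece M) fun a =>
    (φ.pushOf N a).comp
      (AddMonoidHom.mk' (fun m : M.piece (φ.deg a) =>
        (⟨ψ.toLin (m : M.carrier), ψ.map_mem m.2⟩ : N.piece (φ.deg a)))
        (fun _ _ => Subtype.ext (map_add ψ.toLin _ _)))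

theorem pushMapAdd_pushOf (φ : Mor 𝒜' B' 𝒜 B) {M : GrMod.{u, v, w} 𝒜'}
    {N : GrMod.{u, v, w'} 𝒜'} (ψ : M.Hom N) (a : A) (m : M.piece (φ.deg a)) :
    φ.pushMapAdd ψ (φ.pushOf M a m) =
      φ.pushOf N a ⟨ψ.toLin (m : M.carrier), ψ.map_mem m.2⟩ :=
  DirectSum.toAddMonoid_of (β := φ.PushPiece M) _ a m

/-- The map on push-forwards induced by a homomorphism of graded modules. -/
def pushMapLin (φ : Mor 𝒜' B' 𝒜 B) {M : GrMod.{u, v, w} 𝒜'} {N : GrMod.{u, v, w'} 𝒜'}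
    (ψ : M.Hom N) : φ.PushType M →ₗ[T] φ.PushType N where
  toFun := φ.pushMapAdd ψ
  map_add' := map_add _
  map_smul' := by
    intro t x
    rw [RingHom.id_apply]
    induction t using DirectSum.Decomposition.inductionOn 𝒜 with
    | zero => simp
    | add s t hs ht => rw [add_smul, map_add, hs, ht, add_smul]
    | @homogeneous b t =>
      induction x using φ.push_induction M with
      | zero => simp
      | add x y hx hy => rw [smul_add, map_add, hx, hy, map_add, smul_add]
      | of a m =>
        rw [φ.smul_pushOf M t.2 m (φ.smul_pushOf_mem M t.2 m), pushMapAdd_pushOf,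
          pushMapAdd_pushOf, φ.smul_pushOf N t.2 _ (φ.smul_pushOf_mem N t.2 _)]
        exact φ.pushOf_congr N rfl (map_smul ψ.toLin _ _)

theorem pushMapLin_pushOf (φ : Mor 𝒜' B' 𝒜 B) {M : GrMod.{u, v, w} 𝒜'}
    {N : GrMod.{u, v, w'} 𝒜'} (ψ : M.Hom N) (a : A) (m : M.piece (φ.deg a)) :
    φ.pushMapLin ψ (φ.pushOf M a m) =
      φ.pushOf N a ⟨ψ.toLin (m : M.carrier), ψ.map_mem m.2⟩ :=
  φ.pushMapAdd_pushOf ψ a m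

theorem pushProj_pushMapLin (φ : Mor 𝒜' B' 𝒜 B) {M : GrMod.{u, v, w} 𝒜'}
    {N : GrMod.{u, v, w'} 𝒜'} (ψ : M.Hom N) (a : A) (x : φ.PushType M) :
    (φ.pushProj N a (φ.pushMapLin ψ x) : N.carrier) = ψ.toLin (φ.pushProj M a x) := by
  induction x using φ.push_induction M with
  | zero => simp
  | add x y hx hy => simp [hx, hy]
  | of c m =>
    rw [pushMapLin_pushOf]
    by_cases hc : c = a
    · subst hc
      rw [pushProj_pushOf, pushProj_pushOf]
    · rw [pushProj_pushOf_ne φ N hc, pushProj_pushOf_ne φ M hc]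
      simp

theorem push_isLocalized (φ : Mor 𝒜' B' 𝒜 B) {M : GrMod.{u, v, w} 𝒜'}
    {N : GrMod.{u, v, w'} 𝒜'} (ψ : M.Hom N) {g : T} (hg : ∃ b, g ∈ 𝒜 b)
    (h : IsLocalizedModule (Submonoid.powers (φ.ring g)) ψ.toLin) :
    IsLocalizedModule (Submonoid.powers g) (φ.pushMapLin ψ) where
  map_units := by
    rintro ⟨_, n, rfl⟩
    obtain ⟨b, hb⟩ := hg
    rw [map_pow]
    refine IsUnit.pow n ?_
    have hu : Function.Bijective fun m : N.carrier => φ.ring g • m :=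
      (Module.End.isUnit_iff _).1 (h.map_units ⟨φ.ring g, 1, pow_one _⟩)
    rw [Module.End.isUnit_iff]
    constructor
    · rw [injective_iff_map_eq_zero]
      intro x hx
      change g • x = 0 at hx
      refine φ.push_ext N fun a => Subtype.ext (hu.1 ?_)
      change φ.ring g • _ = φ.ring g • _
      rw [← φ.pushProj_smul N hb, hx]
      simp
    · intro y
      change ∃ x : φ.PushType N, g • x = y
      induction y using φ.push_induction N with
      | zero => exact ⟨0, smul_zero _⟩
      | add x y hx hy =>
        obtain ⟨x, rfl⟩ := hx
        obtain ⟨y, rfl⟩ := hy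
        exact ⟨x + y, smul_add _ _ _⟩
      | of a n =>
        obtain ⟨m, hm⟩ := hu.2 (n : N.carrier)
        have hm' : m ∈ N.piece (φ.deg (a - b)) := by
          refine N.mem_of_smul_mem (φ.map_mem hb) hu.1 ?_
          rw [← map_add, add_sub_cancel]
          exact (show φ.ring g • m = n from hm) ▸ n.2
        refine ⟨φ.pushOf N (a - b) ⟨m, hm'⟩, ?_⟩
        rw [φ.smul_pushOf N hb _ (φ.smul_pushOf_mem N hb _)]
        exact φ.pushOf_congr N (add_sub_cancel _ _) hm
  surj := by
    obtain ⟨b, hb⟩ := hg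
    intro y
    suffices H : ∃ (x : φ.PushType M) (n : ℕ), g ^ n • y = φ.pushMapLin ψ x by
      obtain ⟨x, n, hx⟩ := H
      exact ⟨(x, ⟨g ^ n, n, rfl⟩), hx⟩
    induction y using φ.push_induction N with
    | zero => exact ⟨0, 0, by simp⟩
    | add x y hx hy =>
      obtain ⟨x', n, hx⟩ := hx
      obtain ⟨y', m, hy⟩ := hy
      refine ⟨g ^ m • x' + g ^ n • y', n + m, ?_⟩
      rw [map_add, map_smul, map_smul, ← hx, ← hy, smul_add, smul_smul, smul_smul, ← pow_add,
        ← pow_add, add_comm m n]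
    | of a n =>
      obtain ⟨⟨m, ⟨_, i, rfl⟩⟩, hm⟩ := h.surj (n : N.carrier)
      change φ.ring g ^ i • (n : N.carrier) = ψ.toLin m at hm
      rw [← map_pow] at hm
      have hgi : g ^ i ∈ 𝒜 (i • b) := SetLike.pow_mem_graded i hb
      have hmem : ψ.toLin m ∈ N.piece (φ.deg (i • b + a)) :=
        hm ▸ φ.smul_pushOf_mem N hgi n
      obtain ⟨m', hm', e⟩ := GrMod.exists_homogeneous_preimage ψ hmem
      refine ⟨φ.pushOf M (i • b + a) ⟨m', hm'⟩, i, ?_⟩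
      rw [φ.smul_pushOf N hgi n (φ.smul_pushOf_mem N hgi n), pushMapLin_pushOf]
      exact φ.pushOf_congr N rfl (hm.trans e.symm)
  exists_of_eq := by
    classical
    obtain ⟨b, hb⟩ := hg
    intro x y hxy
    have hz : ∀ a, ψ.toLin (φ.pushProj M a (x - y) : M.carrier) = 0 := by
      intro a
      rw [← pushProj_pushMapLin, map_sub, hxy, sub_self, map_zero]
      rfl
    have hn : ∀ a, ∃ n : ℕ, φ.ring g ^ n • (φ.pushProj M a (x - y) : M.carrier) = 0 := by
      intro a
      obtain ⟨⟨_, n, rfl⟩, hc⟩ := h.exists_of_eq ((hz a).trans (map_zero ψ.toLin).symm)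
      exact ⟨n, hc.trans (smul_zero _)⟩
    choose n hn using hn
    let s : Finset A := DFinsupp.support (show Π₀ a, φ.PushPiece M a from x - y)
    have hs : ∀ a, a ∉ s → φ.pushProj M a (x - y) = 0 := fun a ha =>
      DFinsupp.notMem_support_iff.1 ha
    refine ⟨⟨g ^ (∑ a ∈ s, n a), _, rfl⟩, ?_⟩
    change g ^ (∑ a ∈ s, n a) • x = g ^ (∑ a ∈ s, n a) • y
    rw [← sub_eq_zero, ← smul_sub]
    have hgi : g ^ (∑ a ∈ s, n a) ∈ 𝒜 ((∑ a ∈ s, n a) • b) := SetLike.pow_mem_graded _ hb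
    refine φ.push_ext M fun a => Subtype.ext ?_
    rw [← add_sub_cancel ((∑ a ∈ s, n a) • b) a, φ.pushProj_smul M hgi, map_zero]
    change _ = 0
    by_cases ha : a - (∑ a ∈ s, n a) • b ∈ s
    · rw [map_pow, ← Finset.sum_erase_add s n ha, pow_add, mul_smul]
      rw [Finset.sum_erase_add s n ha, hn, smul_zero]
    · rw [hs _ ha]; simp

end Mor

/-- The push-forward `φ_* F` of quasi-coherent sheaves along an affine morphism `φ`.  By the
projection formula, `Γ(U, (φ_* F)(a)) = Γ(φ⁻¹ U, F ⊗ φ^* 𝒪(a)) = Γ(φ⁻¹ U, F(deg a))`. -/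
def QCoh.pushforward [GradedAlgebra 𝒜] (φ : Mor 𝒜' B' 𝒜 B) (F : QCoh.{u, v, w} 𝒜' B') :
    QCoh.{u, v, max v w} 𝒜 B where
  sec U := φ.push (F.sec (φ.preimage U))
  res h :=
    { toLin := φ.pushMapLin (F.res (φ.preimage_mono h))
      map_mem := by
        rintro a _ ⟨m, rfl⟩
        exact ⟨_, (φ.pushMapLin_pushOf _ a m).symm⟩ }
  res_refl U x := φ.push_ext _ fun a => Subtype.ext <|
    (φ.pushProj_pushMapLin _ a x).trans (F.res_refl _ _)
  res_trans h₁ h₂ x := φ.push_ext _ fun a => Subtype.ext <|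
    (φ.pushProj_pushMapLin _ a _).trans <|
      (congrArg _ (φ.pushProj_pushMapLin _ a x)).trans <|
        (F.res_trans _ _ _).trans (φ.pushProj_pushMapLin _ a x).symm
  isLocalized {U V} h := φ.push_isLocalized _ V.homog (F.isLocalized (φ.preimage_mono h))

end Pushforward

section Koszul

variable {R : Type w} [CommRing R] {r : ℕ}

/-- The term `K_p = ⋀^p R^r` of the Koszul complex on `r` elements: the free module with basis
`e_s = e_{i₁} ∧ ⋯ ∧ e_{i_p}`, for the subsets `s = {i₁ < ⋯ < i_p}` of `{0, …, r - 1}`. -/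
abbrev Koszul (R : Type w) (r p : ℕ) : Type w := {s : Finset (Fin r) // s.card = p} → R

/-- The differential `K_{p+1} → K_p`,
`e_{i₀} ∧ ⋯ ∧ e_{i_p} ↦ ∑_j (-1)^j f_{i_j} e_{i₀} ∧ ⋯ ê_{i_j} ⋯ ∧ e_{i_p}`.
In coordinates, the coefficient at `e_t` of the image of `v` is the sum over `i ∉ t` of
`(-1)^j f_i` times the coefficient of `v` at `t ∪ {i}`, `j` being the number of elements of `t`
below `i`. -/
def koszulD (f : Fin r → R) (p : ℕ) : Koszul R r (p + 1) →ₗ[R] Koszul R r p where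
  toFun v t := ∑ i : {i : Fin r // i ∉ t.1},
    (-1) ^ (t.1.filter (· < i.1)).card * f i.1 *
      v ⟨insert i.1 t.1, by rw [Finset.card_insert_of_notMem i.2, t.2]⟩
  map_add' v v' := by
    ext t
    simp [mul_add, Finset.sum_add_distrib]
  map_smul' c v := by
    ext t
    simp only [Pi.smul_apply, smul_eq_mul, RingHom.id_apply, Finset.mul_sum]
    exact Finset.sum_congr rfl fun _ _ => by ring

theorem koszulD_apply (f : Fin r → R) (p : ℕ) (v : Koszul R r (p + 1))
    (t : {s : Finset (Fin r) // s.card = p}) :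
    koszulD f p v t = ∑ i : {i : Fin r // i ∉ t.1},
      (-1) ^ (t.1.filter (· < i.1)).card * f i.1 *
        v ⟨insert i.1 t.1, by rw [Finset.card_insert_of_notMem i.2, t.2]⟩ :=
  rfl

variable [Algebra T R] {𝒜 : A → Submodule k T}

/-- The terms of the Koszul complex as graded modules, when `R` is graded by `ℛ` and `e_i` has
degree `d i`, so that `K_p = ⨁_s R(-∑_{i ∈ s} d i)`. -/
def koszulGr (ℛ : A → AddSubgroup R) (hℛ : DirectSum.IsInternal ℛ)
    (hsmul : ∀ {a b : A} {t : T} {x : R}, t ∈ 𝒜 a → x ∈ ℛ b → t • x ∈ ℛ (a + b))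
    (d : Fin r → A) (p : ℕ) : GrMod.{u, v, w} 𝒜 where
  carrier := Koszul R r p
  piece a :=
    { carrier := {v | ∀ s : {s : Finset (Fin r) // s.card = p}, v s ∈ ℛ (a - ∑ i ∈ s.1, d i)}
      zero_mem' := fun _ => zero_mem _
      add_mem' := fun hv hw s => add_mem (hv s) (hw s)
      neg_mem' := fun hv s => neg_mem (hv s) }
  isInternal := by
    classical
    refine isInternal_of_sum ?_ ?_
    · rw [eq_top_iff]
      intro v _
      have hv : v = ∑ s, Pi.single s (v s) := (Finset.univ_sum_single v).symm
      rw [hv]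
      refine sum_mem fun s _ => ?_
      generalize v s = y
      have hy : y ∈ ⨆ a, ℛ a := iSup_eq_top_of_isInternal hℛ ▸ AddSubgroup.mem_top _
      induction hy using AddSubgroup.iSup_induction' with
      | hp a x hx =>
        refine AddSubgroup.mem_iSup_of_mem (a + ∑ i ∈ s.1, d i) fun t => ?_
        by_cases h : t = s
        · subst h; simpa using hx
        · rw [Pi.single_eq_of_ne h]; exact zero_mem _
      | h1 => rw [Pi.single_zero]; exact zero_mem _
      | hadd x y _ _ hx hy => rw [Pi.single_add]; exact add_mem hx hy
    · intro s x hx h0 a ha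
      funext t
      refine eq_zero_of_sum_of_isInternal hℛ s (fun a => a - ∑ i ∈ t.1, d i)
        (fun _ _ e => sub_left_injective e) (fun a => x a t) (fun a _ => hx a t) ?_ a ha
      simpa using congrFun h0 t
  smul_mem := by
    intro a b t v ht hv s
    rw [add_sub_assoc]
    exact hsmul ht (hv s)

theorem koszulD_mem (ℛ : A → AddSubgroup R)
    (hmul : ∀ {a b : A} {x y : R}, x ∈ ℛ a → y ∈ ℛ b → x * y ∈ ℛ (a + b))
    (d : Fin r → A) (f : Fin r → R) (hf : ∀ i, f i ∈ ℛ (d i)) (p : ℕ) (a : A)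
    (v : Koszul R r (p + 1))
    (hv : ∀ s : {s : Finset (Fin r) // s.card = p + 1}, v s ∈ ℛ (a - ∑ i ∈ s.1, d i))
    (t : {s : Finset (Fin r) // s.card = p}) :
    koszulD f p v t ∈ ℛ (a - ∑ i ∈ t.1, d i) := by
  rw [koszulD_apply]
  refine AddSubgroup.sum_mem _ fun i _ => ?_
  have h := hmul (hf i.1) (hv ⟨insert i.1 t.1, by rw [Finset.card_insert_of_notMem i.2, t.2]⟩)
  rw [Finset.sum_insert i.2, show d i.1 + (a - (d i.1 + ∑ j ∈ t.1, d j)) =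
    a - ∑ j ∈ t.1, d j by abel] at h
  rcases neg_one_pow_eq_or R (t.1.filter (· < i.1)).card with e | e
  · rw [e, one_mul]; exact h
  · rw [e, neg_one_mul, neg_mul]; exact neg_mem h

/-- The Koszul differential as a homomorphism of graded modules, when `f i` is homogeneous of
degree `d i`. -/
def koszulGrD (ℛ : A → AddSubgroup R) (hℛ : DirectSum.IsInternal ℛ)
    (hsmul : ∀ {a b : A} {t : T} {x : R}, t ∈ 𝒜 a → x ∈ ℛ b → t • x ∈ ℛ (a + b))
    (hmul : ∀ {a b : A} {x y : R}, x ∈ ℛ a → y ∈ ℛ b → x * y ∈ ℛ (a + b))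
    (d : Fin r → A) (f : Fin r → R) (hf : ∀ i, f i ∈ ℛ (d i)) (p : ℕ) :
    (koszulGr ℛ hℛ hsmul d (p + 1)).Hom (koszulGr ℛ hℛ hsmul d p) where
  toLin := (koszulD f p).restrictScalars T
  map_mem {a v} hv := koszulD_mem ℛ hmul d f hf p a v hv

end Koszul

section Fan

variable {N : Type v} [AddCommGroup N]

/-- The ray spanned by the lattice vector `n` in `N ⊗ ℚ`. -/
def ray (n : N) : PointedCone ℚ (ℚ ⊗[ℤ] N) := PointedCone.hull ℚ {(1 : ℚ) ⊗ₜ[ℤ] n}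

/-- A (rational, polyhedral) fan in `N ⊗ ℚ`, together with an enumeration `ρ₀, …, ρ_{r-1}` of its
rays, given by their primitive lattice generators `gen i`. -/
structure Fan (N : Type v) [AddCommGroup N] (r : ℕ) where
  cones : Set (PointedCone ℚ (ℚ ⊗[ℤ] N))
  finite : cones.Finite
  nonempty : cones.Nonempty
  fg : ∀ σ ∈ cones, σ.FG
  salient : ∀ σ ∈ cones, (σ : ConvexCone ℚ (ℚ ⊗[ℤ] N)).Salient
  face_mem : ∀ σ ∈ cones, ∀ τ : PointedCone ℚ (ℚ ⊗[ℤ] N), τ.IsFaceOf σ → τ ∈ cones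
  inter_isFaceOf : ∀ σ ∈ cones, ∀ τ ∈ cones, (σ ⊓ τ).IsFaceOf σ
  gen : Fin r → N
  gen_injective : Function.Injective gen
  gen_primitive : ∀ (i : Fin r) (c : ℤ) (n : N), gen i = c • n → IsUnit c
  ray_gen_mem : ∀ i, ray (gen i) ∈ cones
  exists_gen : ∀ σ ∈ cones, Module.finrank ℚ (Submodule.span ℚ (σ : Set (ℚ ⊗[ℤ] N))) = 1 →
    ∃ i, σ = ray (gen i)

namespace Fan

variable {r : ℕ} (X : Fan N r)

/-- The fan covers `N ⊗ ℚ`. -/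
def IsComplete : Prop := ∀ v : ℚ ⊗[ℤ] N, ∃ σ ∈ X.cones, v ∈ σ

/-- The toric variety of the fan is projective: the fan is complete and it carries a strictly
convex integral support function, that is, there are `m_σ ∈ M = Hom(N, ℤ)`, for the maximal cones
`σ`, such that on each `σ` the function `m_σ` is the smallest of all of these, and is strictly
smaller than `m_τ` off `τ`. -/
def IsProjective : Prop :=
  X.IsComplete ∧ ∃ m : PointedCone ℚ (ℚ ⊗[ℤ] N) → Module.Dual ℤ N,
    ∀ σ τ, Maximal (· ∈ X.cones) σ → Maximal (· ∈ X.cones) τ → ∀ v ∈ σ,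
      (m σ).baseChange ℚ v ≤ (m τ).baseChange ℚ v ∧
        ((m σ).baseChange ℚ v = (m τ).baseChange ℚ v → v ∈ τ)

/-- The map `M → ℤ^{Σ(1)}`, `m ↦ div(χ^m) = (⟨m, gen i⟩)_i`. -/
def divMap : Module.Dual ℤ N →ₗ[ℤ] (Fin r → ℤ) :=
  LinearMap.pi fun i => Module.Dual.eval ℤ N (X.gen i)

/-- The divisor class group `Cl(X) = ℤ^{Σ(1)} / M`. -/
abbrev Cl : Type := (Fin r → ℤ) ⧸ LinearMap.range X.divMap

instance : DecidableEq X.Cl := Classical.decEq _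

/-- The class of the torus-invariant prime divisor `D_i`; this is the degree of `x_i`. -/
def deg (i : Fin r) : X.Cl := Submodule.Quotient.mk (Pi.single i 1)

/-- The effective classes: the semigroup generated by the classes of the `D_i`. -/
def Eff : AddSubmonoid X.Cl := AddSubmonoid.closure (Set.range X.deg)

theorem deg_mem_eff (i : Fin r) : X.deg i ∈ X.Eff := AddSubmonoid.subset_closure ⟨i, rfl⟩

variable (k : Type u) [Field k]

/-- The Cox ring `S = k[x_i]`. -/
abbrev S (_X : Fan N r) : Type u := MvPolynomial (Fin r) k

/-- The `Cl(X)`-grading of the Cox ring. -/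
abbrev grS : X.Cl → Submodule k (X.S k) := MvPolynomial.weightedHomogeneousSubmodule k X.deg

instance : GradedAlgebra (X.grS k) := MvPolynomial.weightedGradedAlgebra k X.deg

open Classical in
/-- The irrelevant ideal `B = ⟨∏_{ρ_i ⊄ σ} x_i : σ ∈ Σ⟩`.  The toric stack of the fan is
`𝒳 = [(Spec S ∖ V(B))/G]` with `G = Hom(Cl(X), 𝔾ₘ)`. -/
def irr : Ideal (X.S k) :=
  Ideal.span ((fun σ => ∏ i with ¬ ray (X.gen i) ≤ σ, MvPolynomial.X i) '' X.cones)

/-- The Cox ring `S' = k[x_i, y_i]` of `𝒳 × 𝒳`; `x_i` is `X (inl i)` and `y_i` is `X (inr i)`. -/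
abbrev S' (_X : Fan N r) : Type u := MvPolynomial (Fin r ⊕ Fin r) k

/-- The degrees `(deg x_i, 0)` of `x_i` and `(0, deg x_i)` of `y_i` in `Cl(X) ⊕ Cl(X)`. -/
def deg' : Fin r ⊕ Fin r → X.Cl × X.Cl := Sum.elim (fun i => (X.deg i, 0)) (fun i => (0, X.deg i))

/-- The `Cl(X) ⊕ Cl(X)`-grading of `S'`. -/
abbrev grS' : X.Cl × X.Cl → Submodule k (X.S' k) :=
  MvPolynomial.weightedHomogeneousSubmodule k X.deg'

instance : GradedAlgebra (X.grS' k) := MvPolynomial.weightedGradedAlgebra k X.deg'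

/-- The ideal `B'` of `S'` with `Spec S' ∖ V(B') = (Spec S ∖ V(B)) × (Spec S ∖ V(B))`, so that
`𝒳 × 𝒳 = [(Spec S' ∖ V(B'))/(G × G)]`. -/
def irr' : Ideal (X.S' k) :=
  (X.irr k).map (MvPolynomial.rename Sum.inl : X.S k →ₐ[k] X.S' k) *
    (X.irr k).map (MvPolynomial.rename Sum.inr : X.S k →ₐ[k] X.S' k)

/-- Quasi-coherent sheaves on the toric stack `𝒳`. -/
abbrev QCohX := QCoh.{u, 0, w} (X.grS k) (X.irr k)

/-- Quasi-coherent sheaves on `𝒳 × 𝒳`. -/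
abbrev QCohXX := QCoh.{u, 0, w} (X.grS' k) (X.irr' k)

theorem weight_diag (d : Fin r ⊕ Fin r →₀ ℕ) :
    Finsupp.weight X.deg (d.mapDomain (Sum.elim id id)) =
      (Finsupp.weight X.deg' d).1 + (Finsupp.weight X.deg' d).2 := by
  induction d using Finsupp.induction_linear with
  | zero => simp
  | add d e hd he =>
    rw [Finsupp.mapDomain_add, map_add, map_add, hd, he, Prod.fst_add, Prod.snd_add]
    abel
  | single i n =>
    rw [Finsupp.mapDomain_single, Finsupp.weight_single, Finsupp.weight_single]
    cases i <;> simp [deg']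

/-- The diagonal morphism `Δ : 𝒳 → 𝒳 × 𝒳`: it is induced by the diagonal morphism of
`Spec S ∖ V(B)`, that is, by `S' → S`, `x_i ↦ x_i`, `y_i ↦ x_i`, and by the diagonal homomorphism
`G → G × G`, which is dual to the addition `Cl(X) ⊕ Cl(X) → Cl(X)`. -/
def diagonal : Mor (X.grS k) (X.irr k) (X.grS' k) (X.irr' k) where
  ring := MvPolynomial.rename (Sum.elim id id)
  deg := AddMonoidHom.coprod (AddMonoidHom.id _) (AddMonoidHom.id _)
  map_mem := by
    rintro a p hp d hd
    obtain ⟨e, rfl, he⟩ := MvPolynomial.coeff_rename_ne_zero _ _ _ hd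
    rw [X.weight_diag, hp he]
    rfl
  radical_map := by
    have h1 : ∀ f : Fin r → Fin r ⊕ Fin r, (∀ i, Sum.elim id id (f i) = i) →
        ((X.irr k).map (MvPolynomial.rename f : X.S k →ₐ[k] X.S' k)).map
          (MvPolynomial.rename (Sum.elim id id) : X.S' k →ₐ[k] X.S k) = X.irr k := by
      intro f hf
      have h2 : ∀ p : X.S k, (MvPolynomial.rename (Sum.elim id id) : X.S' k →ₐ[k] X.S k)
          (MvPolynomial.rename f p) = p := by
        intro p
        rw [MvPolynomial.rename_rename, show (Sum.elim id id) ∘ f = id from funext hf,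
          MvPolynomial.rename_id_apply]
      refine le_antisymm ?_ ?_
      · rw [Ideal.map_le_iff_le_comap, Ideal.map_le_iff_le_comap]
        intro p hp
        rw [Ideal.mem_comap, Ideal.mem_comap, h2]
        exact hp
      · intro p hp
        rw [← h2 p]
        exact Ideal.mem_map_of_mem _ (Ideal.mem_map_of_mem _ hp)
    rw [irr', Ideal.map_mul, h1 _ fun _ => rfl, h1 _ fun _ => rfl, Ideal.radical_mul, inf_idem]

/-- The sheaf `𝒪_Δ = Δ_* 𝒪_𝒳` on `𝒳 × 𝒳`. -/
def sheafODelta : X.QCohXX k :=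
  QCoh.pushforward (X.diagonal k) (structureSheaf (X.grS k) (X.irr k))

/-- The semigroup ring `R = S'[Eff(X)]`. -/
abbrev R : Type u := AddMonoidAlgebra (X.S' k) X.Eff

/-- The element `u_i` of `R`: the monomial of the class `deg x_i`. -/
def U (i : Fin r) : X.R k := AddMonoidAlgebra.single ⟨X.deg i, X.deg_mem_eff i⟩ 1

/-- The element `y_i - x_i u_i` of `R`. -/
def koszulElt (i : Fin r) : X.R k :=
  algebraMap (X.S' k) (X.R k) (MvPolynomial.X (Sum.inr i)) -
    algebraMap (X.S' k) (X.R k) (MvPolynomial.X (Sum.inl i)) * X.U k i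

/-- The `Cl(X) ⊕ Cl(X)`-grading of `R`: the monomial of `d ∈ Eff(X)` has degree `(-d, d)`. -/
def grR (a : X.Cl × X.Cl) : AddSubgroup (X.R k) where
  carrier := {x | ∀ d : X.Eff, x.coeff d ∈ X.grS' k (a - (-(d : X.Cl), (d : X.Cl)))}
  zero_mem' _ := zero_mem _
  add_mem' hx hy d := add_mem (hx d) (hy d)
  neg_mem' hx d := neg_mem (hx d)

theorem single_mem_grR {a : X.Cl × X.Cl} (d : X.Eff) {s : X.S' k}
    (hs : s ∈ X.grS' k (a - (-(d : X.Cl), (d : X.Cl)))) :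
    AddMonoidAlgebra.single d s ∈ X.grR k a := by
  classical
  intro e
  rw [AddMonoidAlgebra.coeff_single, Finsupp.single_apply]
  split_ifs with h
  · subst h; exact hs
  · exact zero_mem _

theorem eq_sum_single (x : X.R k) :
    x = ∑ d ∈ x.coeff.support, AddMonoidAlgebra.single d (x.coeff d) := by
  apply (AddMonoidAlgebra.coeffAddEquiv (R := X.S' k) (M := X.Eff)).injective
  rw [map_sum]
  exact (Finsupp.sum_single x.coeff).symm

theorem grR_isInternal : DirectSum.IsInternal (X.grR k) := by
  classical
  refine isInternal_of_sum ?_ ?_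
  · rw [eq_top_iff]
    intro x _
    rw [X.eq_sum_single k x]
    refine sum_mem fun d _ => ?_
    generalize x.coeff d = s
    obtain ⟨t, y, hy, hs⟩ := (GrMod.self (X.grS' k)).exists_sum s
    change s = ∑ a ∈ t, (show X.S' k from y a) at hs
    rw [hs, show AddMonoidAlgebra.single d (∑ a ∈ t, (show X.S' k from y a)) = _ from
      map_sum (AddMonoidAlgebra.singleAddHom d) _ t]
    refine sum_mem fun a _ => AddSubgroup.mem_iSup_of_mem (a + (-(d : X.Cl), (d : X.Cl))) ?_
    refine X.single_mem_grR k d ?_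
    rw [add_sub_cancel_right]
    exact hy a
  · intro t x hx h0 a ha
    refine AddMonoidAlgebra.ext (Finsupp.ext fun d => ?_)
    have h := eq_zero_of_sum_of_isInternal (GrMod.self (X.grS' k)).isInternal t
      (fun a => a - (-(d : X.Cl), (d : X.Cl))) (fun _ _ e => sub_left_injective e)
      (fun a => (x a).coeff d) (fun a _ => hx a d) ?_ a ha
    · exact h
    · have h1 := congrArg (fun z => (AddMonoidAlgebra.coeffAddEquiv (R := X.S' k) (M := X.Eff)) z d) h0
      simp only [map_sum, map_zero, Finsupp.finsetSum_apply] at h1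
      exact h1

theorem grR_mul {a b : X.Cl × X.Cl} {x y : X.R k} (hx : x ∈ X.grR k a) (hy : y ∈ X.grR k b) :
    x * y ∈ X.grR k (a + b) := by
  rw [X.eq_sum_single k x, X.eq_sum_single k y, Finset.sum_mul_sum]
  refine sum_mem fun d _ => sum_mem fun e _ => ?_
  rw [AddMonoidAlgebra.single_mul_single]
  refine X.single_mem_grR k _ ?_
  have h := SetLike.mul_mem_graded (hx d) (hy e)
  convert h using 2
  ext <;> simp <;> abel

theorem grR_algebraMap {a : X.Cl × X.Cl} {t : X.S' k} (ht : t ∈ X.grS' k a) :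
    algebraMap (X.S' k) (X.R k) t ∈ X.grR k a := by
  rw [AddMonoidAlgebra.coe_algebraMap]
  exact X.single_mem_grR k 0 (by
    have h : a - (-((0 : X.Eff) : X.Cl), ((0 : X.Eff) : X.Cl)) = a := by ext <;> simp
    rw [h]; exact ht)

theorem grR_smul {a b : X.Cl × X.Cl} {t : X.S' k} {x : X.R k} (ht : t ∈ X.grS' k a)
    (hx : x ∈ X.grR k b) : t • x ∈ X.grR k (a + b) := by
  rw [Algebra.smul_def]
  exact X.grR_mul k (X.grR_algebraMap k ht) hx

theorem koszulElt_mem (i : Fin r) : X.koszulElt k i ∈ X.grR k (0, X.deg i) := by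
  refine sub_mem (X.grR_algebraMap k (MvPolynomial.isWeightedHomogeneous_X k X.deg' (Sum.inr i))) ?_
  have h := X.grR_mul k
    (X.grR_algebraMap k (MvPolynomial.isWeightedHomogeneous_X k X.deg' (Sum.inl i)))
    (X.single_mem_grR k (a := (-X.deg i, X.deg i)) ⟨X.deg i, X.deg_mem_eff i⟩ (s := 1) (by
      rw [sub_self]; exact SetLike.GradedOne.one_mem))
  have e : X.deg' (Sum.inl i) + (-X.deg i, X.deg i) = (0, X.deg i) := by ext <;> simp [deg']
  rw [e] at h
  exact h

/-- The terms of the Koszul complex `F` on the elements `y_i - x_i u_i`, as graded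
`S'`-modules. -/
def koszulF (p : ℕ) : GrMod.{u, 0, u} (X.grS' k) :=
  koszulGr (X.grR k) (X.grR_isInternal k) (X.grR_smul k) (fun i => (0, X.deg i)) p

/-- The differential `F_{p+1} → F_p`. -/
def koszulFD (p : ℕ) : (X.koszulF k (p + 1)).Hom (X.koszulF k p) :=
  koszulGrD (X.grR k) (X.grR_isInternal k) (X.grR_smul k) (X.grR_mul k) (fun i => (0, X.deg i))
    (X.koszulElt k) (X.koszulElt_mem k) p

/-- `H_0(F)` as a graded `S'`-module. -/
def koszulH0 : GrMod.{u, 0, u} (X.grS' k) := GrMod.coker (X.koszulFD k 0)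

end Fan
end Fan

end ToricStack

end

/-! Write `u^d` for the monomial of `d ∈ Eff(X)` and `f_i = y_i - x_i u_i`. Everything rests on two
ways of moving the variables `y_i`.

Acyclicity: for `j ∉ J`, the element `f_j` is a nonzerodivisor modulo the ideal of the `f_i`, `i ∈
J` (`koszulElt_weaklyRegular`). Substituting `x_i u_i` for `y_i`, `i ∈ J`, eliminates these
variables without moving `f_j`, and the translation `y_i ↦ y_i + x_i u_i` turns `f_j` into the
variable `y_j`. Such a family has an acyclic Koszul complex, by induction on the number of elements
through mapping cones (`exists_koszulSum_eq`).

The sheaf `𝒪_Δ` comes from the graded module `⨁ S_{a+b}`, summed over pairs `(a, b)` of classes.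
Sending `u^d` to `1` in degree `(-d, d)` defines a graded map from `R` to this module. Its kernel is
the ideal of all the `f_i` (`augR_eq_zero_iff`): eliminating the `y_i` identifies the quotient with
`S[Eff(X)]`, and the module embeds as an additive group in `S[Cl(X)]` by remembering only `b`. The
image consists of the summands with `b` effective.

The cokernel is killed locally by powers of the irrelevant ideal (`exists_pow_smul_mem_range_augR`).
For a cone `τ`, multiplying by the product of the `y_i` with `ρ_i ⊄ τ` adds to `b` the class of the
divisors off `τ`, and sufficiently many such additions make any class effective
(`exists_add_nsmul_mem_eff`). This is where projectivity enters: it supplies an integral functional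
that is positive on `τ ∖ {0}`. An injective map with torsion cokernel becomes an isomorphism on
every chart (`nonempty_iso_pushforward`), and exactness of localization turns `F` into a resolution.
-/

noncomputable section

namespace ToricStack

universe u v w w' w''

/-! ### Exactness of the Koszul complex of a weakly regular family. -/

section KoszulAcyclic

variable {R : Type*} [CommRing R] {r : ℕ}

/-- The Koszul differential on the elements `f i`, `i ∈ J`, on functions on all finite subsets. -/
def koszulSum (f : Fin r → R) (J : Finset (Fin r)) (v : Finset (Fin r) → R)
    (t : Finset (Fin r)) : R :=
  ∑ i ∈ J \ t, (-1) ^ (t.filter (· < i)).card * f i * v (insert i t)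

theorem koszulSum_congr (f : Fin r → R) (J : Finset (Fin r)) {v w : Finset (Fin r) → R}
    (t : Finset (Fin r)) (h : ∀ i ∈ J, i ∉ t → v (insert i t) = w (insert i t)) :
    koszulSum f J v t = koszulSum f J w t :=
  Finset.sum_congr rfl fun i hi => by
    rw [Finset.mem_sdiff] at hi
    rw [h i hi.1 hi.2]

/-- When `j` exceeds all of `J`, the complex on `insert j J` is a mapping cone of multiplication by
`±f j` on the complex on `J`. This is its component off `j`; the sign is that of moving past all of
`t`. -/
theorem koszulSum_insert_of_subset (f : Fin r → R) {J : Finset (Fin r)} {j : Fin r}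
    (hj : ∀ i ∈ J, i < j) (v : Finset (Fin r) → R) {t : Finset (Fin r)} (ht : t ⊆ J) :
    koszulSum f (insert j J) v t =
      koszulSum f J v t + (-1) ^ t.card * f j * v (insert j t) := by
  have hjJ : j ∉ J := fun h => lt_irrefl _ (hj j h)
  rw [koszulSum, Finset.insert_sdiff_of_notMem _ fun h => hjJ (ht h), Finset.sum_insert
    fun h => hjJ (Finset.mem_sdiff.1 h).1, add_comm, Finset.filter_true_of_mem
    fun i hi => hj i (ht hi)]
  rfl

/-- The other component of the cone: `j` is already used up, and being the largest index it is
counted in none of the signs. -/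
theorem koszulSum_insert_insert (f : Fin r → R) {J : Finset (Fin r)} {j : Fin r}
    (hj : ∀ i ∈ J, i < j) (v : Finset (Fin r) → R) (t : Finset (Fin r)) :
    koszulSum f (insert j J) v (insert j t) = koszulSum f J (fun s => v (insert j s)) t := by
  have hjJ : j ∉ J := fun h => lt_irrefl _ (hj j h)
  have h : insert j J \ insert j t = J \ t := by
    ext i
    simp only [Finset.mem_sdiff, Finset.mem_insert]
    constructor
    · tauto
    · rintro ⟨h1, h2⟩
      exact ⟨Or.inr h1, fun h => h.elim (fun e => hjJ (e ▸ h1)) h2⟩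
  rw [koszulSum, h]
  refine Finset.sum_congr rfl fun i hi => ?_
  rw [Finset.filter_insert, if_neg (hj i (Finset.mem_sdiff.1 hi).1).le.not_gt, Finset.insert_comm]

/-- The differential compares sets whose sizes differ by one, so it anticommutes with the sign `(-1)
^ card`. -/
theorem koszulSum_sign (f : Fin r → R) (J : Finset (Fin r)) (c : R) (v : Finset (Fin r) → R)
    (t : Finset (Fin r)) :
    koszulSum f J (fun s => (-1) ^ s.card * c * v s) t =
      -((-1) ^ t.card * c * koszulSum f J v t) := by
  rw [koszulSum, koszulSum, Finset.mul_sum, ← Finset.sum_neg_distrib]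
  refine Finset.sum_congr rfl fun i hi => ?_
  rw [Finset.card_insert_of_notMem (Finset.mem_sdiff.1 hi).2, pow_succ]
  ring

theorem koszulSum_add (f : Fin r → R) (J : Finset (Fin r)) (v w : Finset (Fin r) → R)
    (t : Finset (Fin r)) :
    koszulSum f J (fun s => v s + w s) t = koszulSum f J v t + koszulSum f J w t := by
  simp only [koszulSum, mul_add, Finset.sum_add_distrib]

theorem subset_or_eq_insert {J : Finset (Fin r)} {j : Fin r} {t : Finset (Fin r)}
    (ht : t ⊆ insert j J) : t ⊆ J ∨ ∃ s ⊆ J, t = insert j s := by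
  by_cases h : j ∈ t
  · exact Or.inr ⟨t.erase j, by rwa [← Finset.subset_insert_iff], (Finset.insert_erase h).symm⟩
  · exact Or.inl ((Finset.subset_insert_iff_of_notMem h).1 ht)

theorem koszulSum_koszulSum (f : Fin r → R) (J : Finset (Fin r)) :
    ∀ (v : Finset (Fin r) → R), ∀ t ⊆ J, koszulSum f J (koszulSum f J v) t = 0 := by
  induction J using Finset.induction_on_max with
  | empty => intro v t _; simp [koszulSum]
  | insert j J hj ih =>
    intro v t ht
    rcases subset_or_eq_insert ht with ht | ⟨t, hs, rfl⟩
    · rw [koszulSum_insert_of_subset f hj _ ht, koszulSum_insert_insert f hj,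
        koszulSum_congr f J (w := fun s => koszulSum f J v s +
          (-1) ^ s.card * f j * v (insert j s)) t fun i hi _ =>
          koszulSum_insert_of_subset f hj v (Finset.insert_subset hi ht),
        koszulSum_add, ih v t ht, koszulSum_sign f J (f j) (fun s => v (insert j s))]
      ring
    · rw [koszulSum_insert_insert f hj]
      have : (fun s => koszulSum f (insert j J) v (insert j s)) =
          koszulSum f J (fun s => v (insert j s)) :=
        funext fun s => koszulSum_insert_insert f hj v s
      rw [this, ih _ t hs]

/-- All degrees are treated at once; `v ∅ = 0` removes degree `0`, where homology may survive. In
the induction a cycle is a pair consisting of its restriction to `J` and `w'`, its part containing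
`j`. The part `w'` is a cycle over `J` that can have a component in degree `0`, and regularity of `f
j` is what makes that component a boundary. -/
theorem exists_koszulSum_eq (f : Fin r → R) (hf : ∀ (J : Finset (Fin r)) (j : Fin r), j ∉ J →
      ∀ a, f j * a ∈ Ideal.span (f '' J) → a ∈ Ideal.span (f '' J)) (J : Finset (Fin r)) :
    ∀ v : Finset (Fin r) → R, v ∅ = 0 → (∀ t ⊆ J, koszulSum f J v t = 0) →
      ∃ w, ∀ t ⊆ J, koszulSum f J w t = v t := by
  induction J using Finset.induction_on_max with
  | empty =>
    intro v hv _
    refine ⟨0, fun t ht => ?_⟩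
    rw [Finset.subset_empty.1 ht, hv]
    simp [koszulSum]
  | insert j J hj ih =>
    intro v hv hcl
    have hjJ : j ∉ J := fun h => lt_irrefl _ (hj j h)
    let w' : Finset (Fin r) → R := fun s => v (insert j s)
    have hw' : ∀ t ⊆ J, koszulSum f J w' t = 0 := fun t ht => by
      rw [← koszulSum_insert_insert f hj]
      exact hcl _ (Finset.insert_subset_insert j ht)
    have hv' : ∀ t ⊆ J, koszulSum f J v t = -((-1) ^ t.card * f j * w' t) := fun t ht => by
      rw [eq_neg_iff_add_eq_zero, ← koszulSum_insert_of_subset f hj v ht]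
      exact hcl _ (ht.trans (Finset.subset_insert _ _))
    -- The cycle condition at `∅` says that `f j * w' ∅` lies in the ideal of the `f i`, `i ∈ J`.
    obtain ⟨c, hc⟩ : ∃ c : Fin r → R, ∑ i ∈ J, f i * c i = w' ∅ := by
      have h1 : w' ∅ ∈ Ideal.span (f '' J) := by
        refine hf J j hjJ _ ?_
        have h2 := hv' ∅ (Finset.empty_subset _)
        simp only [Finset.card_empty, pow_zero, one_mul] at h2
        rw [← neg_mem_iff, ← h2]
        refine sum_mem fun i hi => Ideal.mul_mem_right _ _ (Ideal.mul_mem_left _ _ ?_)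
        exact Ideal.subset_span ⟨i, (Finset.mem_sdiff.1 hi).1, rfl⟩
      rw [Ideal.span, Submodule.mem_span_image_finset_iff_exists_fun] at h1
      obtain ⟨c, hc⟩ := h1
      refine ⟨fun i => if h : i ∈ J then c ⟨i, h⟩ else 0, ?_⟩
      rw [← hc, ← Finset.sum_coe_sort]
      exact Finset.sum_congr rfl fun i _ => by simp [mul_comm]
    -- Resetting the value at `∅` keeps a cycle, because the differential only evaluates at nonempty
    -- sets `insert i t`.
    obtain ⟨w₁, hw₁⟩ := ih (Function.update w' ∅ 0) (by simp) fun t ht => by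
      rw [← hw' t ht]
      exact koszulSum_congr f J t fun i _ _ =>
        Function.update_of_ne (Finset.insert_nonempty i t).ne_empty _ _
    -- On singletons `w₂` uses `c`, to reach `w' ∅`; on larger sets it uses `w₁`. The value `0` at
    -- `∅` is free, and it is needed to apply the induction hypothesis once more.
    obtain ⟨w₂, hw₂, hw₂0⟩ : ∃ w₂, (∀ t ⊆ J, koszulSum f J w₂ t = w' t) ∧ w₂ ∅ = 0 := by
      refine ⟨fun s => if s.card = 0 then 0 else if s.card = 1 then ∑ i ∈ s, c i else w₁ s,
        fun t ht => ?_, by simp⟩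
      rcases t.eq_empty_or_nonempty with rfl | hne
      · rw [← hc]
        simp [koszulSum]
      · rw [← Function.update_of_ne hne.ne_empty 0 w', ← hw₁ t ht]
        refine koszulSum_congr f J t fun i _ hi => ?_
        have := hne.card_pos
        simp only [Finset.card_insert_of_notMem hi]
        rw [if_neg (by omega), if_neg (by omega)]
    -- Subtracting the contribution of `w₂` through `f j` leaves a cycle over `J`.
    obtain ⟨w₃, hw₃⟩ := ih (fun s => v s + (-1) ^ s.card * (-f j) * w₂ s) (by simp [hv, hw₂0])
      fun t ht => by
        rw [koszulSum_add, koszulSum_sign, hv' t ht, hw₂ t ht]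
        ring
    refine ⟨fun s => if j ∈ s then w₂ (s.erase j) else w₃ s, fun t ht => ?_⟩
    rcases subset_or_eq_insert ht with ht | ⟨t, hs, rfl⟩
    · have hjt : j ∉ t := fun h => hjJ (ht h)
      rw [koszulSum_insert_of_subset f hj _ ht, if_pos (Finset.mem_insert_self _ _),
        Finset.erase_insert hjt, koszulSum_congr f J (w := w₃) t fun i hi _ => ?_, hw₃ t ht]
      · ring
      · rw [if_neg]
        rw [Finset.mem_insert]
        exact fun h => h.elim (fun e => hjJ (e ▸ hi)) hjt
    · rw [koszulSum_insert_insert f hj]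
      refine Eq.trans (koszulSum_congr f J t fun i hi _ => ?_) (hw₂ t hs)
      rw [if_pos (Finset.mem_insert_self _ _), Finset.erase_insert]
      rw [Finset.mem_insert]
      exact fun h => h.elim (fun e => hjJ (e ▸ hi)) fun h => hjJ (hs h)

/-- Extension by zero of an element of the Koszul complex to all finite subsets. -/
def koszulExt {p : ℕ} (v : Koszul R r p) (s : Finset (Fin r)) : R :=
  if h : s.card = p then v ⟨s, h⟩ else 0

theorem koszulExt_apply {p : ℕ} (v : Koszul R r p) (t : {s : Finset (Fin r) // s.card = p}) :
    koszulExt v t.1 = v t :=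
  dif_pos t.2

/-- Only the values of `w` on sets of size `p + 1` matter. This freedom is used for the primitive
from `exists_koszulSum_eq`, which need not vanish in other sizes. -/
theorem koszulD_eq_koszulSum (f : Fin r → R) (p : ℕ) (v : Koszul R r (p + 1))
    (w : Finset (Fin r) → R) (h : ∀ s, w s.1 = v s) (t : {s : Finset (Fin r) // s.card = p}) :
    koszulD f p v t = koszulSum f Finset.univ w t.1 := by
  rw [koszulD_apply, koszulSum]
  simp only [← h]
  refine (Finset.sum_subtype (Finset.univ \ t.1) (fun i => by simp) (fun i =>
    (-1) ^ (t.1.filter (· < i)).card * f i * w (insert i t.1))).symm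

/-- Extension by zero commutes with the differentials, since the differential lowers the size by
exactly one. -/
theorem koszulSum_koszulExt (f : Fin r → R) {p : ℕ} (v : Koszul R r (p + 1)) :
    koszulSum f Finset.univ (koszulExt v) = koszulExt (koszulD f p v) := by
  funext s
  by_cases h : s.card = p
  · rw [← koszulD_eq_koszulSum f p v _ (koszulExt_apply v) ⟨s, h⟩]
    exact (koszulExt_apply _ ⟨s, h⟩).symm
  · rw [koszulExt, dif_neg h]
    refine Finset.sum_eq_zero fun i hi => ?_
    rw [koszulExt, dif_neg, mul_zero]
    rw [Finset.card_insert_of_notMem (Finset.mem_sdiff.1 hi).2]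
    omega

/-- The Koszul complex on a weakly regular family is acyclic. -/
theorem koszulD_exact (f : Fin r → R) (hf : ∀ (J : Finset (Fin r)) (j : Fin r), j ∉ J →
      ∀ a, f j * a ∈ Ideal.span (f '' J) → a ∈ Ideal.span (f '' J)) (p : ℕ) :
    Function.Exact (koszulD f (p + 1)) (koszulD f p) := by
  intro v
  constructor
  · intro hv
    obtain ⟨w, hw⟩ := exists_koszulSum_eq f hf Finset.univ (koszulExt v)
      (dif_neg (by simp)) fun t _ => by
        rw [koszulSum_koszulExt, hv]
        simp [koszulExt]
    -- The homogeneous part of the primitive `w`, on sets of size `p + 2`, suffices.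
    refine ⟨fun s => w s.1, funext fun t => ?_⟩
    rw [koszulD_eq_koszulSum f _ _ w (fun _ => rfl), hw _ (Finset.subset_univ _), koszulExt_apply]
  · rintro ⟨w, rfl⟩
    funext t
    rw [koszulD_eq_koszulSum f _ _ _ (koszulExt_apply _), ← koszulSum_koszulExt,
      koszulSum_koszulSum f _ _ _ (Finset.subset_univ _)]
    rfl

end KoszulAcyclic

namespace Fan

/-! ### Substitutions in `R` and regularity of the elements `y_i - x_i u_i`. -/

section Regular

variable {N : Type v} [AddCommGroup N] {r : ℕ} (X : Fan N r) (k : Type u) [Field k]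

/-- The ring homomorphism from `R` that sends `x_i` to `a i`, `y_i` to `b i` and is given by `c`
on constants and by `e` on the monomials of `Eff(X)`. -/
def liftR {Q : Type*} [CommRing Q] (c : k →+* Q) (a b : Fin r → Q)
    (e : Multiplicative X.Eff →* Q) : X.R k →+* Q :=
  AddMonoidAlgebra.liftNCRingHom (MvPolynomial.eval₂Hom c (Sum.elim a b)) e
    fun _ _ => Commute.all _ _

theorem liftR_single {Q : Type*} [CommRing Q] (c : k →+* Q) (a b : Fin r → Q)
    (e : Multiplicative X.Eff →* Q) (d : X.Eff) (t : X.S' k) :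
    X.liftR k c a b e (AddMonoidAlgebra.single d t) =
      MvPolynomial.eval₂Hom c (Sum.elim a b) t * e (Multiplicative.ofAdd d) :=
  AddMonoidAlgebra.liftNC_single _ _ _ _

theorem algebraMap_R (t : X.S' k) :
    algebraMap (X.S' k) (X.R k) t = AddMonoidAlgebra.single 0 t := by
  rw [AddMonoidAlgebra.coe_algebraMap]
  rfl

theorem liftR_algebraMap {Q : Type*} [CommRing Q] (c : k →+* Q) (a b : Fin r → Q)
    (e : Multiplicative X.Eff →* Q) (t : X.S' k) :
    X.liftR k c a b e (algebraMap (X.S' k) (X.R k) t) =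
      MvPolynomial.eval₂Hom c (Sum.elim a b) t := by
  rw [algebraMap_R, liftR_single, ofAdd_zero, map_one, mul_one]

theorem ringHom_ext_R {Q : Type*} [CommRing Q] {φ ψ : X.R k →+* Q}
    (hC : ∀ c : k, φ (algebraMap (X.S' k) (X.R k) (MvPolynomial.C c)) =
      ψ (algebraMap (X.S' k) (X.R k) (MvPolynomial.C c)))
    (hx : ∀ i, φ (algebraMap (X.S' k) (X.R k) (MvPolynomial.X (Sum.inl i))) =
      ψ (algebraMap (X.S' k) (X.R k) (MvPolynomial.X (Sum.inl i))))
    (hy : ∀ i, φ (algebraMap (X.S' k) (X.R k) (MvPolynomial.X (Sum.inr i))) =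
      ψ (algebraMap (X.S' k) (X.R k) (MvPolynomial.X (Sum.inr i))))
    (hu : ∀ d : X.Eff, φ (AddMonoidAlgebra.single d 1) = ψ (AddMonoidAlgebra.single d 1)) :
    φ = ψ := by
  refine AddMonoidAlgebra.ringHom_ext (fun t => ?_) hu
  have h : φ.comp (algebraMap (X.S' k) (X.R k)) = ψ.comp (algebraMap (X.S' k) (X.R k)) :=
    MvPolynomial.ringHom_ext hC (by rintro (i | i); exacts [hx i, hy i])
  rw [← algebraMap_R]
  exact congrArg (fun χ : X.S' k →+* Q => χ t) h

/-- The endomorphism of `R` that sends `y_i` to `g i` and fixes the `x_i` and the monomials of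
`Eff(X)`. -/
def substY (g : Fin r → X.R k) : X.R k →+* X.R k :=
  X.liftR k ((algebraMap (X.S' k) (X.R k)).comp MvPolynomial.C)
    (fun i => algebraMap (X.S' k) (X.R k) (MvPolynomial.X (Sum.inl i))) g
    (AddMonoidAlgebra.of (X.S' k) X.Eff)

@[simp]
theorem substY_C (g : Fin r → X.R k) (c : k) :
    X.substY k g (algebraMap (X.S' k) (X.R k) (MvPolynomial.C c)) =
      algebraMap (X.S' k) (X.R k) (MvPolynomial.C c) := by
  rw [substY, liftR_algebraMap, MvPolynomial.eval₂Hom_C]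
  rfl

@[simp]
theorem substY_x (g : Fin r → X.R k) (i : Fin r) :
    X.substY k g (algebraMap (X.S' k) (X.R k) (MvPolynomial.X (Sum.inl i))) =
      algebraMap (X.S' k) (X.R k) (MvPolynomial.X (Sum.inl i)) := by
  rw [substY, liftR_algebraMap, MvPolynomial.eval₂Hom_X', Sum.elim_inl]

@[simp]
theorem substY_y (g : Fin r → X.R k) (i : Fin r) :
    X.substY k g (algebraMap (X.S' k) (X.R k) (MvPolynomial.X (Sum.inr i))) = g i := by
  rw [substY, liftR_algebraMap, MvPolynomial.eval₂Hom_X', Sum.elim_inr]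

@[simp]
theorem substY_monomial (g : Fin r → X.R k) (d : X.Eff) :
    X.substY k g (AddMonoidAlgebra.single d 1) = AddMonoidAlgebra.single d 1 := by
  rw [substY, liftR_single, map_one, one_mul]
  rfl

@[simp]
theorem substY_U (g : Fin r → X.R k) (i : Fin r) : X.substY k g (X.U k i) = X.U k i :=
  X.substY_monomial k g _

/-- Modulo `I` the substitution agrees with the identity on generators. -/
theorem substY_sub_mem (g : Fin r → X.R k) (I : Ideal (X.R k))
    (hg : ∀ i, g i - algebraMap (X.S' k) (X.R k) (MvPolynomial.X (Sum.inr i)) ∈ I) (z : X.R k) :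
    X.substY k g z - z ∈ I := by
  have h : (Ideal.Quotient.mk I).comp (X.substY k g) = Ideal.Quotient.mk I := by
    refine X.ringHom_ext_R k (Q := X.R k ⧸ I) (fun c => ?_) (fun i => ?_) (fun i => ?_)
      fun d => ?_ <;> rw [RingHom.comp_apply]
    · rw [substY_C]
    · rw [substY_x]
    · rw [substY_y, Ideal.Quotient.mk_eq_mk_iff_sub_mem]
      exact hg _
    · rw [substY_monomial]
  rw [← Ideal.Quotient.mk_eq_mk_iff_sub_mem]
  exact congrArg (fun χ : X.R k →+* X.R k ⧸ I => χ z) h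

theorem substY_substY (g g' : Fin r → X.R k)
    (h : ∀ i, X.substY k g' (g i) = algebraMap (X.S' k) (X.R k) (MvPolynomial.X (Sum.inr i)))
    (z : X.R k) : X.substY k g' (X.substY k g z) = z := by
  have h : (X.substY k g').comp (X.substY k g) = RingHom.id _ := by
    apply X.ringHom_ext_R k <;> intros <;> rw [RingHom.comp_apply]
    · rw [substY_C, substY_C]; rfl
    · rw [substY_x, substY_x]; rfl
    · rw [substY_y, h]; rfl
    · rw [substY_monomial, substY_monomial]; rfl
  exact congrArg (fun χ : X.R k →+* X.R k => χ z) h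

/-- The automorphism `y_i ↦ y_i + x_i u_i` carries `y_j - x_j u_j` to `y_j`. Torsion in `Cl(X)` can
give `R` zero divisors, so the argument is coefficientwise: `y_j` is a nonzero scalar from the
domain `S'`. -/
theorem eq_zero_of_koszulElt_mul (j : Fin r) (z : X.R k) (h : X.koszulElt k j * z = 0) :
    z = 0 := by
  let y : Fin r → X.R k := fun i => algebraMap (X.S' k) (X.R k) (MvPolynomial.X (Sum.inr i))
  let c : Fin r → X.R k := fun i =>
    algebraMap (X.S' k) (X.R k) (MvPolynomial.X (Sum.inl i)) * X.U k i
  have h1 := congrArg (X.substY k (fun i => y i + c i)) h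
  rw [map_mul, map_zero, koszulElt, map_sub, map_mul, substY_y, substY_x, substY_U,
    add_sub_cancel_right] at h1
  have h2 : X.substY k (fun i => y i + c i) z = 0 := by
    refine AddMonoidAlgebra.ext (Finsupp.ext fun d => ?_)
    have h3 := congrArg (fun z => z.coeff d) h1
    simp only [y, ← Algebra.smul_def, AddMonoidAlgebra.coeff_smul_apply, smul_eq_mul] at h3
    exact (mul_eq_zero.1 h3).resolve_left (MvPolynomial.X_ne_zero _)
  rw [← X.substY_substY k (fun i => y i + c i) (fun i => y i - c i) (fun i => ?_) z, h2, map_zero]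
  rw [map_add, map_mul, substY_y, substY_x, substY_U, sub_add_cancel]

/-- Substituting `x_i u_i` for `y_i`, `i ∈ J`, kills the ideal, is the identity modulo it, and fixes
the `j`-th element. Hence the image of `a` is annihilated by that element and vanishes, so `a` is in
the ideal. -/
theorem koszulElt_weaklyRegular (J : Finset (Fin r)) (j : Fin r) (hj : j ∉ J) (a : X.R k)
    (h : X.koszulElt k j * a ∈ Ideal.span (X.koszulElt k '' J)) :
    a ∈ Ideal.span (X.koszulElt k '' J) := by
  classical
  let g : Fin r → X.R k := fun i => if i ∈ J then
    algebraMap (X.S' k) (X.R k) (MvPolynomial.X (Sum.inl i)) * X.U k i else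
    algebraMap (X.S' k) (X.R k) (MvPolynomial.X (Sum.inr i))
  have hJ : Ideal.span (X.koszulElt k '' J) ≤ RingHom.ker (X.substY k g) := by
    rw [Ideal.span_le]
    rintro _ ⟨i, hi, rfl⟩
    rw [SetLike.mem_coe, RingHom.mem_ker, koszulElt, map_sub, map_mul, substY_y, substY_x,
      substY_U]
    simp only [g]
    rw [if_pos (Finset.mem_coe.1 hi), sub_self]
  have h1 := hJ h
  have h2 : X.substY k g (X.koszulElt k j) = X.koszulElt k j := by
    rw [koszulElt, map_sub, map_mul, substY_y, substY_x, substY_U]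
    simp only [g]
    rw [if_neg hj]
  rw [RingHom.mem_ker, map_mul, h2] at h1
  have h3 := X.substY_sub_mem k g (Ideal.span (X.koszulElt k '' J)) (fun i => ?_) a
  · rwa [X.eq_zero_of_koszulElt_mul k j _ h1, zero_sub, neg_mem_iff] at h3
  · simp only [g]
    split_ifs with hi
    · rw [← neg_mem_iff, neg_sub]
      exact Ideal.subset_span ⟨i, hi, rfl⟩
    · rw [sub_self]
      exact zero_mem _

theorem koszulElt_exact (p : ℕ) :
    Function.Exact (koszulD (X.koszulElt k) (p + 1)) (koszulD (X.koszulElt k) p) :=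
  koszulD_exact _ (X.koszulElt_weaklyRegular k) p

end Regular

/-! ### Positivity on cones and effective classes. -/

section Effective

variable {N : Type v} [AddCommGroup N] {r : ℕ} (X : Fan N r)

theorem gen_ne_zero (i : Fin r) : X.gen i ≠ 0 := fun h =>
  not_isUnit_zero (X.gen_primitive i 0 0 (by rw [h, smul_zero]))

/-- Integral functionals separate the points of a free module, and they extend to `ℚ ⊗ N`. -/
theorem one_tmul_ne_zero [Module.Free ℤ N] {n : N} (hn : n ≠ 0) : (1 : ℚ) ⊗ₜ[ℤ] n ≠ 0 := by
  intro h
  refine hn ((Module.forall_dual_apply_eq_zero_iff ℤ n).1 fun φ => ?_)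
  have h1 := congrArg (φ.baseChange ℚ) h
  rw [Module.Dual.baseChange_apply_tmul, map_zero] at h1
  simpa using h1

/-- On a projective fan, each cone has an integral functional that is positive on its nonzero
elements. -/
theorem exists_dual_pos (hX : X.IsProjective) {τ : PointedCone ℚ (ℚ ⊗[ℤ] N)} (hτ : τ ∈ X.cones) :
    ∃ l : Module.Dual ℤ N, ∀ v ∈ τ, v ≠ 0 → 0 < l.baseChange ℚ v := by
  classical
  obtain ⟨hc, m, hm⟩ := hX
  obtain ⟨σ, hτσ, hσ⟩ := X.finite.exists_le_maximal hτ
  let s : Finset (PointedCone ℚ (ℚ ⊗[ℤ] N)) :=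
    X.finite.toFinset.filter fun ρ => Maximal (· ∈ X.cones) ρ
  have hs : ∀ ρ, ρ ∈ s ↔ Maximal (· ∈ X.cones) ρ := fun ρ => by
    simp only [s, Finset.mem_filter, Set.Finite.mem_toFinset, and_iff_right_iff_imp]
    exact fun h => h.prop
  -- Every summand is nonnegative on `σ ⊇ τ`, so it is enough that for each `v` one of them is
  -- positive.
  refine ⟨∑ ρ ∈ s, (m ρ - m σ), fun v hv hv0 => ?_⟩
  rw [map_sum, LinearMap.sum_apply]
  have hle : ∀ ρ ∈ s, 0 ≤ (m ρ - m σ).baseChange ℚ v := fun ρ hρ => by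
    rw [map_sub, LinearMap.sub_apply, sub_nonneg]
    exact (hm σ ρ hσ ((hs ρ).1 hρ) v (hτσ hv)).1
  -- Take a maximal cone `ρ` containing `-v`. If its summand vanished at `v`, strict convexity would
  -- put `v` in `ρ` too, which contradicts salience.
  obtain ⟨ρ₀, hρ₀, hv'⟩ := hc (-v)
  obtain ⟨ρ, hρ₀ρ, hρ⟩ := X.finite.exists_le_maximal hρ₀
  refine Finset.sum_pos' hle ⟨ρ, (hs ρ).2 hρ, lt_of_le_of_ne (hle ρ ((hs ρ).2 hρ)) fun h => ?_⟩
  rw [map_sub, LinearMap.sub_apply, eq_comm, sub_eq_zero, eq_comm] at h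
  exact X.salient ρ hρ.prop v ((hm σ ρ hσ hρ v (hτσ hv)).2 h) hv0 (hρ₀ρ hv')

theorem mk_eq_sum_deg (b : Fin r → ℤ) :
    (Submodule.Quotient.mk b : X.Cl) = ∑ i, b i • X.deg i := by
  conv_lhs => rw [← Finset.univ_sum_single b]
  change (LinearMap.range X.divMap).mkQ _ = _
  rw [map_sum]
  refine Finset.sum_congr rfl fun i _ => ?_
  rw [deg, ← Submodule.mkQ_apply, ← map_smul, ← Pi.single_smul, smul_eq_mul, mul_one]

theorem mk_mem_eff {b : Fin r → ℤ} (hb : ∀ i, 0 ≤ b i) :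
    (Submodule.Quotient.mk b : X.Cl) ∈ X.Eff := by
  rw [mk_eq_sum_deg]
  refine sum_mem fun i _ => ?_
  obtain ⟨n, hn⟩ := Int.eq_ofNat_of_zero_le (hb i)
  rw [hn, natCast_zsmul]
  exact nsmul_mem (X.deg_mem_eff i) n

open Classical in
/-- The class of the divisor complementary to a cone is eventually effective after any twist. -/
theorem exists_add_nsmul_mem_eff [Module.Free ℤ N] (hX : X.IsProjective)
    {τ : PointedCone ℚ (ℚ ⊗[ℤ] N)} (hτ : τ ∈ X.cones) (b : X.Cl) :
    ∃ n : ℕ, b + n • ∑ i with ¬ ray (X.gen i) ≤ τ, X.deg i ∈ X.Eff := by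
  obtain ⟨l, hl⟩ := X.exists_dual_pos hX hτ
  obtain ⟨b, rfl⟩ := Submodule.Quotient.mk_surjective _ b
  have hpos : ∀ i, ray (X.gen i) ≤ τ → 1 ≤ l (X.gen i) := fun i hi => by
    have h := hl _ (hi (Submodule.subset_span rfl)) (one_tmul_ne_zero (X.gen_ne_zero i))
    rw [Module.Dual.baseChange_apply_tmul] at h
    have h' : (0 : ℚ) < (l (X.gen i) : ℚ) := by simpa using h
    exact_mod_cast h'
  -- A bound for all `|b i|`. Since `l` is at least `1` on the generators in `τ`, adding `K` times
  -- the divisor of `l` makes the coefficients there nonnegative.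
  let K : ℤ := ∑ i, |b i|
  have hK : ∀ i, |b i| ≤ K := fun i =>
    Finset.single_le_sum (f := fun i => |b i|) (fun j _ => abs_nonneg (b j)) (Finset.mem_univ i)
  have hK0 : 0 ≤ K := Finset.sum_nonneg fun j _ => abs_nonneg (b j)
  -- Large enough to repair the coefficients at the rays outside `τ`, where `l` has no known sign.
  let n : ℕ := ∑ i, (b i + K * l (X.gen i)).natAbs
  have hn : ∀ i, |b i + K * l (X.gen i)| ≤ n := fun i => by
    rw [Int.abs_eq_natAbs]
    exact_mod_cast Finset.single_le_sum (f := fun i => (b i + K * l (X.gen i)).natAbs)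
      (fun j _ => Nat.zero_le _) (Finset.mem_univ i)
  refine ⟨n, ?_⟩
  have h1 : (Submodule.Quotient.mk b : X.Cl) + n • ∑ i with ¬ ray (X.gen i) ≤ τ, X.deg i =
      Submodule.Quotient.mk (fun i => b i + K * l (X.gen i) +
        if ¬ ray (X.gen i) ≤ τ then (n : ℤ) else 0) := by
    have h2 : (Submodule.Quotient.mk b : X.Cl) =
        Submodule.Quotient.mk (fun i => b i + K * l (X.gen i)) := by
      rw [eq_comm, Submodule.Quotient.eq]
      exact ⟨K • l, funext fun i => by simp [divMap]⟩
    rw [h2, mk_eq_sum_deg, mk_eq_sum_deg, Finset.smul_sum, Finset.sum_filter,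
      ← Finset.sum_add_distrib]
    refine Finset.sum_congr rfl fun i _ => ?_
    rw [add_smul (_ + _)]
    split_ifs <;> simp
  rw [h1]
  refine X.mk_mem_eff fun i => ?_
  split_ifs with hi
  · have h2 := (neg_abs_le (b i)).trans' (neg_le_neg (hK i))
    nlinarith [hpos i hi]
  · linarith [neg_abs_le (b i + K * l (X.gen i)), hn i]

end Effective

end Fan

/-! ### Morphisms out of sheafifications and a criterion for isomorphism. -/

section SheafifyLift

variable {k : Type u} [CommRing k] {A : Type v} [AddCommGroup A] [DecidableEq A]
  {T : Type u} [CommRing T] [Algebra k T] {𝒜 : A → Submodule k T} {B : Ideal T}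

/-- Composition of homomorphisms of graded modules. -/
def GrMod.Hom.comp {L : GrMod.{u, v, w} 𝒜} {M : GrMod.{u, v, w'} 𝒜} {N : GrMod.{u, v, w''} 𝒜}
    (ψ : M.Hom N) (φ : L.Hom M) : L.Hom N where
  toLin := ψ.toLin ∘ₗ φ.toLin
  map_mem h := ψ.map_mem (φ.map_mem h)

/-- The projection onto the cokernel. -/
def GrMod.cokerMk {M : GrMod.{u, v, w} 𝒜} {N : GrMod.{u, v, w'} 𝒜} (φ : M.Hom N) :
    N.Hom (GrMod.coker φ) where
  toLin := (LinearMap.range φ.toLin).mkQ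
  map_mem {_ m} h := ⟨m, h, rfl⟩

/-- The homomorphism out of the cokernel induced by a homomorphism that kills the image. -/
def GrMod.cokerLift {L : GrMod.{u, v, w} 𝒜} {M : GrMod.{u, v, w'} 𝒜} {N : GrMod.{u, v, w''} 𝒜}
    (φ : L.Hom M) (ψ : M.Hom N) (h : LinearMap.range φ.toLin ≤ LinearMap.ker ψ.toLin) :
    (GrMod.coker φ).Hom N where
  toLin := (LinearMap.range φ.toLin).liftQ ψ.toLin h
  map_mem := by
    rintro a _ ⟨m, hm, rfl⟩
    exact ψ.map_mem hm

/-- The localization homomorphism. -/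
def GrMod.toAway [GradedAlgebra 𝒜] (M : GrMod.{u, v, w} 𝒜) (f : T) (hf : ∃ a, f ∈ 𝒜 a) :
    M.Hom (M.away f hf) where
  toLin := LocalizedModule.mkLinearMap (Submonoid.powers f) M.carrier
  map_mem {a m} h := ⟨0, 1, m, SetLike.GradedOne.one_mem, by rwa [add_zero], rfl⟩

/-- Composition of morphisms of quasi-coherent sheaves. -/
def QCoh.Hom.comp {F : QCoh.{u, v, w} 𝒜 B} {G : QCoh.{u, v, w'} 𝒜 B} {H : QCoh.{u, v, w''} 𝒜 B}
    (ψ : QCoh.Hom G H) (φ : QCoh.Hom F G) : QCoh.Hom F H where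
  app U := (ψ.app U).comp (φ.app U)
  naturality h x := (congrArg _ (φ.naturality h x)).trans (ψ.naturality h _)

/-- A morphism of quasi-coherent sheaves that is bijective on charts is an isomorphism. -/
def QCoh.Iso.ofBijective {F : QCoh.{u, v, w} 𝒜 B} {G : QCoh.{u, v, w'} 𝒜 B} (φ : QCoh.Hom F G)
    (hφ : ∀ U, Function.Bijective (φ.app U).toLin) : QCoh.Iso F G where
  hom := φ
  inv :=
    { app := fun U =>
        { toLin := (LinearEquiv.ofBijective (φ.app U).toLin (hφ U)).symm.toLinearMap
          map_mem := by
            intro a y hy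
            obtain ⟨x, rfl⟩ := (hφ U).2 y
            -- Some preimage is homogeneous of the right degree; by injectivity it is `x`.
            obtain ⟨x', hx', e⟩ := GrMod.exists_homogeneous_preimage (φ.app U) hy
            rw [LinearEquiv.coe_coe, LinearEquiv.ofBijective_symm_apply_apply, ← (hφ U).1 e]
            exact hx' }
      naturality := by
        intro U V h y
        obtain ⟨x, rfl⟩ := (hφ U).2 y
        simp only [LinearEquiv.coe_coe, LinearEquiv.ofBijective_symm_apply_apply,
          ← φ.naturality h] }
  hom_inv U x := LinearEquiv.ofBijective_symm_apply_apply (φ.app U).toLin x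
  inv_hom U y := (LinearEquiv.ofBijective (φ.app U).toLin (hφ U)).apply_symm_apply y

theorem QCoh.isUnit_end (G : QCoh.{u, v, w} 𝒜 B) (U : Chart 𝒜 B) (s : Submonoid.powers U.f) :
    IsUnit (algebraMap T (Module.End T (G.sec U).carrier) s) :=
  (G.isLocalized (le_refl U)).map_units s

variable [GradedAlgebra 𝒜]

theorem smul_lift_mk {M : Type w} [AddCommGroup M] [Module T M] {N : Type w'} [AddCommGroup N]
    [Module T N] {f : T} (g : M →ₗ[T] N)
    (hg : ∀ s : Submonoid.powers f, IsUnit (algebraMap T (Module.End T N) s)) (m : M)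
    (s : Submonoid.powers f) :
    (s : T) • LocalizedModule.lift (Submonoid.powers f) g hg (LocalizedModule.mk m s) = g m := by
  rw [← map_smul, smul_mk_self, LocalizedModule.lift_mk_one]

/-- The morphism `M~ → G` defined by a compatible family of homomorphisms `M → Γ(U, G)`. -/
def sheafifyLift {M : GrMod.{u, v, w} 𝒜} {G : QCoh.{u, v, w'} 𝒜 B}
    (α : ∀ U, M.Hom (G.sec U))
    (hα : ∀ {U V : Chart 𝒜 B} (h : V ≤ U) (m : M.carrier),
      (G.res h).toLin ((α U).toLin m) = (α V).toLin m) : (sheafify B M).Hom G where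
  app U :=
    { toLin := LocalizedModule.lift (Submonoid.powers U.f) (α U).toLin (G.isUnit_end U)
      map_mem := by
        rintro a _ ⟨c, s, m, hs, hm, rfl⟩
        refine GrMod.mem_of_smul_mem (G.sec U) hs (smul_inj_of_isUnit (G.isUnit_end U s)) ?_
        rw [add_comm c a]
        exact (smul_lift_mk (α U).toLin (G.isUnit_end U) m s).symm ▸ (α U).map_mem hm }
  naturality {U V} h x := by
    change LocalizedModule (Submonoid.powers U.f) M.carrier at x
    change LocalizedModule.lift _ _ _ (awayRes h M.carrier x) = _
    induction x using LocalizedModule.induction_on with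
    | h m s =>
      -- `U.f` divides a power of `V.f`, so denominators from `U` are also invertible on sections
      -- over `V`, and the equality can be checked after clearing them.
      have hs : IsUnit (algebraMap T (Module.End T (G.sec V).carrier) s) := by
        obtain ⟨n, hn⟩ := h
        obtain ⟨_, i, rfl⟩ := s
        refine isUnit_end_of_dvd (t := (V.f ^ n) ^ i) (pow_dvd_pow_of_dvd hn i) ?_
        rw [← pow_mul]
        exact G.isUnit_end V ⟨V.f ^ (n * i), n * i, rfl⟩
      refine smul_inj_of_isUnit hs ?_
      change (s : T) • _ = (s : T) • _
      rw [← map_smul, awayRes_smul_mk, LocalizedModule.lift_mk_one, ← hα h, ← map_smul]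
      exact congrArg _ (smul_lift_mk (α U).toLin (G.isUnit_end U) m s).symm

/-- On a chart the lift is the canonical comparison between two localizations of the same module. -/
theorem sheafifyLift_bijective {M : GrMod.{u, v, w} 𝒜} {G : QCoh.{u, v, w'} 𝒜 B}
    (α : ∀ U, M.Hom (G.sec U))
    (hα : ∀ {U V : Chart 𝒜 B} (h : V ≤ U) (m : M.carrier),
      (G.res h).toLin ((α U).toLin m) = (α V).toLin m) (U : Chart 𝒜 B)
    (hU : IsLocalizedModule (Submonoid.powers U.f) (α U).toLin) :
    Function.Bijective ((sheafifyLift α hα).app U).toLin :=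
  (IsLocalizedModule.iso (Submonoid.powers U.f) (α U).toLin).bijective

/-- Localizing at `S` cannot distinguish `M` from a submodule with `S`-torsion quotient. -/
theorem isLocalizedModule_comp_of_torsion {S : Submonoid T} {L : Type*} {M : Type*} {N : Type*}
    [AddCommGroup L] [Module T L] [AddCommGroup M] [Module T M] [AddCommGroup N] [Module T N]
    (α : L →ₗ[T] M) (β : M →ₗ[T] N) (hβ : IsLocalizedModule S β) (hα : Function.Injective α)
    (htors : ∀ m, ∃ s : S, s • m ∈ LinearMap.range α) : IsLocalizedModule S (β ∘ₗ α) where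
  map_units := hβ.map_units
  surj y := by
    obtain ⟨⟨m, s⟩, hm⟩ := hβ.surj y
    obtain ⟨s', l, hl⟩ := htors m
    refine ⟨⟨l, s' * s⟩, ?_⟩
    change s • y = β m at hm
    change (s' * s) • y = β (α l)
    rw [mul_smul, hm, hl, Submonoid.smul_def, Submonoid.smul_def, map_smul]
  exists_of_eq {x y} h := by
    obtain ⟨c, hc⟩ := hβ.exists_of_eq (h : β (α x) = β (α y))
    refine ⟨c, hα ?_⟩
    rw [Submonoid.smul_def, Submonoid.smul_def, map_smul, map_smul]
    exact hc

theorem sheafifyMap_exact (B : Ideal T) {L : GrMod.{u, v, w} 𝒜} {M : GrMod.{u, v, w'} 𝒜}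
    {N : GrMod.{u, v, w''} 𝒜} (φ : L.Hom M) (ψ : M.Hom N)
    (h : Function.Exact φ.toLin ψ.toLin) :
    QCoh.Exact (sheafifyMap B φ) (sheafifyMap B ψ) := fun U =>
  LocalizedModule.map_exact (Submonoid.powers U.f) φ.toLin ψ.toLin h

theorem sheafifyMap_epi (B : Ideal T) {M : GrMod.{u, v, w} 𝒜} {N : GrMod.{u, v, w'} 𝒜}
    (φ : M.Hom N) (h : Function.Surjective φ.toLin) : QCoh.Epi (sheafifyMap B φ) := fun U =>
  IsLocalizedModule.map_surjective (Submonoid.powers U.f)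
    (LocalizedModule.mkLinearMap (Submonoid.powers U.f) M.carrier)
    (LocalizedModule.mkLinearMap (Submonoid.powers U.f) N.carrier) φ.toLin h

variable {A' : Type v} [AddCommGroup A'] [DecidableEq A'] {T' : Type u} [CommRing T']
  [Algebra k T'] {𝒜' : A' → Submodule k T'} {B' : Ideal T'} [GradedAlgebra 𝒜']

/-- A homomorphism `M → φ_* K` that is injective with `B`-power torsion cokernel induces an
isomorphism `M~ ≅ φ_* K~`. -/
theorem nonempty_iso_pushforward (φ : Mor 𝒜' B' 𝒜 B) {M : GrMod.{u, v, w} 𝒜}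
    (K : GrMod.{u, v, w'} 𝒜') (α : M.Hom (φ.push K)) (hα : Function.Injective α.toLin)
    (htors : ∀ f ∈ B.radical, ∀ m, ∃ n : ℕ, f ^ n • m ∈ LinearMap.range α.toLin) :
    Nonempty (QCoh.Iso (sheafify B M) (QCoh.pushforward φ (sheafify B' K))) := by
  let β : ∀ U : Chart 𝒜 B, M.Hom ((QCoh.pushforward φ (sheafify B' K)).sec U) := fun U =>
    { toLin := φ.pushMapLin (K.toAway (φ.preimage U).f (φ.preimage U).homog) ∘ₗ α.toLin
      map_mem := by
        intro a m hm
        obtain ⟨x, hx⟩ := α.map_mem hm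
        refine ⟨_, (φ.pushMapLin_pushOf (K.toAway (φ.preimage U).f (φ.preimage U).homog)
          a x).symm.trans ?_⟩
        rw [hx]
        rfl }
  have hβ : ∀ {U V : Chart 𝒜 B} (h : V ≤ U) (m : M.carrier),
      ((QCoh.pushforward φ (sheafify B' K)).res h).toLin ((β U).toLin m) = (β V).toLin m := by
    intro U V h m
    refine φ.push_ext _ fun a => Subtype.ext ?_
    refine (φ.pushProj_pushMapLin _ a _).trans ?_
    refine (congrArg _ (φ.pushProj_pushMapLin _ a (α.toLin m))).trans ?_
    refine Eq.trans ?_ (φ.pushProj_pushMapLin _ a (α.toLin m)).symm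
    exact awayRes_mk_one (φ.preimage_mono h) K.carrier _
  refine ⟨QCoh.Iso.ofBijective (sheafifyLift β hβ) fun U => sheafifyLift_bijective β hβ U ?_⟩
  refine isLocalizedModule_comp_of_torsion α.toLin _
    (φ.push_isLocalized (K.toAway (φ.preimage U).f (φ.preimage U).homog) U.homog ?_) hα
    fun m => ?_
  · exact inferInstanceAs (IsLocalizedModule (Submonoid.powers (φ.ring U.f))
      (LocalizedModule.mkLinearMap (Submonoid.powers (φ.ring U.f)) K.carrier))
  · obtain ⟨n, hn⟩ := htors U.f U.mem m
    exact ⟨⟨U.f ^ n, n, rfl⟩, hn⟩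

end SheafifyLift

namespace Fan

/-! ### The map from `H_0(F)` to the graded module of `𝒪_Δ`. -/

section Diagonal

variable {N : Type v} [AddCommGroup N] {r : ℕ} (X : Fan N r) (k : Type u) [Field k]

/-- The graded `S'`-module `⨁_{(a, b)} S_{a + b}`. -/
abbrev pushS : GrMod.{u, 0, u} (X.grS' k) := (X.diagonal k).push (GrMod.self (X.grS k))

/-- The element of degree `a` of `⨁_{(a, b)} S_{a + b}` defined by a homogeneous polynomial. -/
def ofS (a : X.Cl × X.Cl) (s : X.S k) (hs : s ∈ X.grS k (a.1 + a.2)) : (X.pushS k).carrier :=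
  (X.diagonal k).pushOf (GrMod.self (X.grS k)) a ⟨s, hs⟩

theorem ofS_congr {a b : X.Cl × X.Cl} {s t : X.S k} (hs : s ∈ X.grS k (a.1 + a.2))
    (ht : t ∈ X.grS k (b.1 + b.2)) (hab : a = b) (hst : s = t) :
    X.ofS k a s hs = X.ofS k b t ht :=
  (X.diagonal k).pushOf_congr (GrMod.self (X.grS k)) hab hst

theorem diagonal_ring_mem {a b : X.Cl × X.Cl} {t : X.S' k} (ht : t ∈ X.grS' k a) {s : X.S k}
    (hs : s ∈ X.grS k (b.1 + b.2)) :
    (X.diagonal k).ring t * s ∈ X.grS k ((a + b).1 + (a + b).2) := by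
  rw [Prod.fst_add, Prod.snd_add, add_add_add_comm]
  exact SetLike.mul_mem_graded ((X.diagonal k).map_mem ht) hs

theorem smul_ofS {a b : X.Cl × X.Cl} {t : X.S' k} (ht : t ∈ X.grS' k a) {s : X.S k}
    (hs : s ∈ X.grS k (b.1 + b.2)) :
    t • X.ofS k b s hs =
      X.ofS k (a + b) ((X.diagonal k).ring t * s) (X.diagonal_ring_mem k ht hs) :=
  (X.diagonal k).smul_pushOf (GrMod.self (X.grS k)) ht _ _

theorem one_mem_grS (d : X.Cl) : (1 : X.S k) ∈ X.grS k (-d + d) := by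
  rw [neg_add_cancel]
  exact SetLike.GradedOne.one_mem

/-- The homomorphism `R → ⨁_{(a, b)} S_{a + b}` that sends the monomial of `d ∈ Eff(X)` to
`1 ∈ S_0` in degree `(-d, d)`. -/
def augR : X.R k →ₗ[X.S' k] (X.pushS k).carrier :=
  Finsupp.linearCombination (X.S' k) (fun d : X.Eff =>
    X.ofS k (-(d : X.Cl), (d : X.Cl)) 1 (X.one_mem_grS k d)) ∘ₗ
    (AddMonoidAlgebra.coeffLinearEquiv (X.S' k)).toLinearMap

theorem augR_single (d : X.Eff) (t : X.S' k) :
    X.augR k (AddMonoidAlgebra.single d t) =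
      t • X.ofS k (-(d : X.Cl), (d : X.Cl)) 1 (X.one_mem_grS k d) :=
  Finsupp.linearCombination_single _ _ _

theorem augR_mem {a : X.Cl × X.Cl} {z : X.R k} (hz : z ∈ X.grR k a) :
    X.augR k z ∈ (X.pushS k).piece a := by
  rw [X.eq_sum_single k z, map_sum]
  refine sum_mem fun d _ => ?_
  rw [augR_single]
  have h := (X.pushS k).smul_mem (hz d) (m := X.ofS k (-(d : X.Cl), (d : X.Cl)) 1
    (X.one_mem_grS k d)) ⟨_, rfl⟩
  rwa [sub_add_cancel] at h

/-- Both sides are `x_i ∈ S` placed in the same bidegree `(-d, d + deg x_i)`. This is the relation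
`y_i = x_i u_i` in the target. -/
theorem y_smul_ofS_one (i : Fin r) (d e : X.Eff) (h : (e : X.Cl) = X.deg i + d) :
    (MvPolynomial.X (Sum.inr i) : X.S' k) •
        X.ofS k (-(d : X.Cl), (d : X.Cl)) 1 (X.one_mem_grS k d) =
      (MvPolynomial.X (Sum.inl i) : X.S' k) •
        X.ofS k (-(e : X.Cl), (e : X.Cl)) 1 (X.one_mem_grS k e) := by
  rw [X.smul_ofS k (MvPolynomial.isWeightedHomogeneous_X k X.deg' (Sum.inr i)),
    X.smul_ofS k (MvPolynomial.isWeightedHomogeneous_X k X.deg' (Sum.inl i))]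
  refine X.ofS_congr k _ _ ?_ ?_
  · rw [h]
    ext <;> simp [deg']
  · simp [diagonal]

theorem augR_koszulElt_mul (i : Fin r) (z : X.R k) : X.augR k (X.koszulElt k i * z) = 0 := by
  induction z using AddMonoidAlgebra.induction_linear with
  | zero => rw [mul_zero, map_zero]
  | add x y hx hy => rw [mul_add, map_add, hx, hy, add_zero]
  | single d t =>
    have h := X.y_smul_ofS_one k i (0 + d) (0 + ⟨X.deg i, X.deg_mem_eff i⟩ + d) (by simp)
    rw [koszulElt, U, algebraMap_R, algebraMap_R, sub_mul, AddMonoidAlgebra.single_mul_single,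
      AddMonoidAlgebra.single_mul_single, AddMonoidAlgebra.single_mul_single, map_sub, augR_single,
      augR_single, mul_comm _ t, mul_one, mul_comm _ t, mul_smul, mul_smul, h, sub_self]

theorem rename_inl_mem {c : X.Cl} {s : X.S k} (hs : s ∈ X.grS k c) :
    MvPolynomial.rename Sum.inl s ∈ X.grS' k (c, 0) := by
  intro d hd
  obtain ⟨e, rfl, he⟩ := MvPolynomial.coeff_rename_ne_zero _ _ _ hd
  rw [← hs he]
  clear hd he
  induction e using Finsupp.induction_linear with
  | zero => rw [Finsupp.mapDomain_zero, map_zero, map_zero]; rfl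
  | add e e' h h' => rw [Finsupp.mapDomain_add, map_add, map_add, h, h']; simp
  | single i n =>
    rw [Finsupp.mapDomain_single, Finsupp.weight_single, Finsupp.weight_single]
    simp [deg']

theorem diagonal_rename_inl (s : X.S k) :
    (X.diagonal k).ring (MvPolynomial.rename Sum.inl s) = s := by
  change MvPolynomial.rename (Sum.elim id id) (MvPolynomial.rename Sum.inl s) = s
  rw [MvPolynomial.rename_rename, Sum.elim_comp_inl, MvPolynomial.rename_id_apply]

/-- As `c` is arbitrary, the image contains every summand `S_{a+b}` with `b = d` effective. -/
theorem augR_single_rename_inl (d : X.Eff) {c : X.Cl} {s : X.S k} (hs : s ∈ X.grS k c)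
    (hs' : s ∈ X.grS k (c - (d : X.Cl) + (d : X.Cl))) :
    X.augR k (AddMonoidAlgebra.single d (MvPolynomial.rename Sum.inl s)) =
      X.ofS k (c - (d : X.Cl), (d : X.Cl)) s hs' := by
  rw [augR_single, X.smul_ofS k (X.rename_inl_mem k hs)]
  refine X.ofS_congr k _ _ ?_ ?_
  · ext <;> simp [sub_eq_add_neg]
  · rw [diagonal_rename_inl, mul_one]

/-- The additive map `⨁_{(a, b)} S_{a + b} → ⨁_b S`. -/
def toFinsuppS : (X.pushS k).carrier →+ (X.Cl →₀ X.S k) :=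
  DirectSum.toAddMonoid (β := (X.diagonal k).PushPiece (GrMod.self (X.grS k))) fun a =>
    (Finsupp.singleAddHom a.2).comp ((GrMod.self (X.grS k)).piece _).subtype

theorem toFinsuppS_ofS (a : X.Cl × X.Cl) (s : X.S k) (hs : s ∈ X.grS k (a.1 + a.2)) :
    X.toFinsuppS k (X.ofS k a s hs) = Finsupp.single a.2 s :=
  DirectSum.toAddMonoid_of (β := (X.diagonal k).PushPiece (GrMod.self (X.grS k))) _ a _

theorem toFinsuppS_augR_single (d : X.Eff) (s : X.S k) :
    X.toFinsuppS k (X.augR k (AddMonoidAlgebra.single d (MvPolynomial.rename Sum.inl s))) =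
      Finsupp.single (d : X.Cl) s := by
  induction s using DirectSum.Decomposition.inductionOn (X.grS k) with
  | zero => simp
  | add s t hs ht =>
    rw [map_add, AddMonoidAlgebra.single_add, map_add, map_add, hs, ht, Finsupp.single_add]
  | @homogeneous c s =>
    rw [X.augR_single_rename_inl k d s.2 (by rw [sub_add_cancel]; exact s.2), toFinsuppS_ofS]

/-- The homomorphism `R → S[Eff(X)]` that sends `y_i` to `x_i u_i`. -/
def elimY : X.R k →+* AddMonoidAlgebra (X.S k) X.Eff :=
  X.liftR k (AddMonoidAlgebra.singleZeroRingHom.comp MvPolynomial.C)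
    (fun i => AddMonoidAlgebra.single 0 (MvPolynomial.X i))
    (fun i => AddMonoidAlgebra.single ⟨X.deg i, X.deg_mem_eff i⟩ (MvPolynomial.X i))
    (AddMonoidAlgebra.of (X.S k) X.Eff)

/-- The inclusion `S[Eff(X)] → S'[Eff(X)]`. -/
def inclX : AddMonoidAlgebra (X.S k) X.Eff →+* X.R k :=
  AddMonoidAlgebra.liftNCRingHom ((algebraMap (X.S' k) (X.R k)).comp
    (MvPolynomial.rename Sum.inl : X.S k →ₐ[k] X.S' k).toRingHom)
    (AddMonoidAlgebra.of (X.S' k) X.Eff) fun _ _ => Commute.all _ _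

theorem inclX_single (d : X.Eff) (s : X.S k) :
    X.inclX k (AddMonoidAlgebra.single d s) =
      AddMonoidAlgebra.single d (MvPolynomial.rename Sum.inl s) := by
  refine (AddMonoidAlgebra.liftNC_single _ _ _ _).trans ?_
  change algebraMap (X.S' k) (X.R k) (MvPolynomial.rename Sum.inl s) *
    AddMonoidAlgebra.single d 1 = _
  rw [algebraMap_R, AddMonoidAlgebra.single_mul_single, zero_add, mul_one]

/-- Hence each `z` is congruent, modulo the Koszul elements, to a normal form without the variables
`y_i`. -/
theorem inclX_elimY (z : X.R k) :
    X.inclX k (X.elimY k z) = X.substY k (fun i =>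
      algebraMap (X.S' k) (X.R k) (MvPolynomial.X (Sum.inl i)) * X.U k i) z := by
  have h : (X.inclX k).comp (X.elimY k) = X.substY k (fun i =>
      algebraMap (X.S' k) (X.R k) (MvPolynomial.X (Sum.inl i)) * X.U k i) := by
    refine X.ringHom_ext_R k (Q := X.R k) (fun c => ?_) (fun i => ?_) (fun i => ?_)
      fun d => ?_ <;> rw [RingHom.comp_apply]
    · rw [substY_C, elimY, liftR_algebraMap, MvPolynomial.eval₂Hom_C]
      change X.inclX k (AddMonoidAlgebra.single 0 (MvPolynomial.C c)) = _
      rw [inclX_single, MvPolynomial.rename_C, algebraMap_R]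
    · rw [substY_x, elimY, liftR_algebraMap, MvPolynomial.eval₂Hom_X', Sum.elim_inl,
        inclX_single, MvPolynomial.rename_X, algebraMap_R]
    · rw [substY_y, elimY, liftR_algebraMap, MvPolynomial.eval₂Hom_X', Sum.elim_inr,
        inclX_single, MvPolynomial.rename_X, algebraMap_R, U, AddMonoidAlgebra.single_mul_single,
        zero_add, mul_one]
    · rw [substY_monomial, elimY, liftR_single, map_one, one_mul]
      change X.inclX k (AddMonoidAlgebra.single d 1) = _
      rw [inclX_single, map_one]
  exact congrArg (fun χ : X.R k →+* X.R k => χ z) h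

/-- On normal forms the map to `⨁_b S` is the extension by zero from `Eff(X)` to `Cl(X)`, which is
injective. -/
theorem toFinsuppS_augR_inclX (w : AddMonoidAlgebra (X.S k) X.Eff) :
    X.toFinsuppS k (X.augR k (X.inclX k w)) = w.coeff.mapDomain (Subtype.val : X.Eff → X.Cl) := by
  induction w using AddMonoidAlgebra.induction_linear with
  | zero => simp
  | add x y hx hy =>
    rw [map_add, map_add, map_add, hx, hy, AddMonoidAlgebra.coeff_add, Finsupp.mapDomain_add]
  | single d s =>
    rw [inclX_single, toFinsuppS_augR_single, AddMonoidAlgebra.coeff_single,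
      Finsupp.mapDomain_single]

/-- The Koszul elements are killed, so `z` and its normal form have the same image. If that image is
zero, the normal form is zero, and `z` is congruent to it modulo the ideal. -/
theorem augR_eq_zero_iff (z : X.R k) :
    X.augR k z = 0 ↔ z ∈ Ideal.span (Set.range (X.koszulElt k)) := by
  have hle : ∀ z ∈ Ideal.span (Set.range (X.koszulElt k)), X.augR k z = 0 := by
    intro z hz
    obtain ⟨c, rfl⟩ := Ideal.mem_span_range_iff_exists_fun.1 hz
    rw [map_sum]
    exact Finset.sum_eq_zero fun i _ => by rw [mul_comm, augR_koszulElt_mul]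
  refine ⟨fun hz => ?_, hle z⟩
  have h1 := X.substY_sub_mem k (fun i =>
    algebraMap (X.S' k) (X.R k) (MvPolynomial.X (Sum.inl i)) * X.U k i)
    (Ideal.span (Set.range (X.koszulElt k))) (fun i => by
      rw [← neg_mem_iff, neg_sub]
      exact Ideal.subset_span ⟨i, rfl⟩) z
  rw [← inclX_elimY] at h1
  have h2 := hle _ h1
  rw [map_sub, hz, sub_zero] at h2
  have h3 := X.toFinsuppS_augR_inclX k (X.elimY k z)
  rw [h2, map_zero] at h3
  have h4 : X.elimY k z = 0 := AddMonoidAlgebra.coeff_injective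
    (Finsupp.mapDomain_injective Subtype.val_injective (h3.symm.trans Finsupp.mapDomain_zero.symm))
  rwa [h4, map_zero, zero_sub, neg_mem_iff] at h1

open Classical in
theorem exists_prod_pow_smul_ofS_mem [Module.Free ℤ N] (hX : X.IsProjective)
    {τ : PointedCone ℚ (ℚ ⊗[ℤ] N)} (hτ : τ ∈ X.cones) (a : X.Cl × X.Cl) (s : X.S k)
    (hs : s ∈ X.grS k (a.1 + a.2)) :
    ∃ n : ℕ, (∏ i with ¬ ray (X.gen i) ≤ τ, MvPolynomial.X (Sum.inr i) : X.S' k) ^ n •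
      X.ofS k a s hs ∈ LinearMap.range (X.augR k) := by
  obtain ⟨n, hn⟩ := X.exists_add_nsmul_mem_eff hX hτ a.2
  have ht : (∏ i with ¬ ray (X.gen i) ≤ τ, MvPolynomial.X (Sum.inr i) : X.S' k) ^ n ∈
      X.grS' k (n • ∑ i with ¬ ray (X.gen i) ≤ τ, X.deg' (Sum.inr i)) :=
    SetLike.pow_mem_graded n (SetLike.prod_mem_graded (X.grS' k) _ _ fun i _ =>
      MvPolynomial.isWeightedHomogeneous_X k X.deg' (Sum.inr i))
  have hfst : (∑ i with ¬ ray (X.gen i) ≤ τ, X.deg' (Sum.inr i)).1 = 0 := by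
    rw [Prod.fst_sum]
    exact Finset.sum_eq_zero fun i _ => rfl
  have hsnd : (∑ i with ¬ ray (X.gen i) ≤ τ, X.deg' (Sum.inr i)).2 =
      ∑ i with ¬ ray (X.gen i) ≤ τ, X.deg i := Prod.snd_sum
  refine ⟨n, ?_⟩
  rw [X.smul_ofS k ht hs]
  have hm := X.diagonal_ring_mem k ht hs
  -- After multiplication the second degree is the effective class from `hn`; the preimage is its
  -- monomial, with the polynomial written in the variables `x_i` alone.
  refine ⟨_, (X.augR_single_rename_inl k ⟨_, hn⟩ hm (by rw [sub_add_cancel]; exact hm)).trans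
    (X.ofS_congr k _ _ ?_ rfl)⟩
  ext
  · simp only [Prod.fst_add, Prod.snd_add, Prod.smul_fst, Prod.smul_snd, hfst, hsnd]
    abel
  · simp only [Prod.snd_add, Prod.smul_snd, hsnd]
    abel

/-- The ring elements with a power multiplying the given element into the image form a radical
ideal. It contains the generators of the second factor of `irr'`, the one in the `y_i`, hence the
whole product. -/
theorem irr'_le_radical [Module.Free ℤ N] (hX : X.IsProjective) (a : X.Cl × X.Cl) (s : X.S k)
    (hs : s ∈ X.grS k (a.1 + a.2)) :
    X.irr' k ≤ Ideal.radical ((LinearMap.range (X.augR k)).comap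
      (LinearMap.toSpanSingleton (X.S' k) (X.pushS k).carrier (X.ofS k a s hs))) := by
  refine Ideal.mul_le_right.trans ?_
  rw [Ideal.map_le_iff_le_comap, irr, Ideal.span_le]
  rintro _ ⟨τ, hτ, rfl⟩
  obtain ⟨n, hn⟩ := X.exists_prod_pow_smul_ofS_mem k hX hτ a s hs
  refine ⟨n, ?_⟩
  rw [map_prod]
  simp only [MvPolynomial.rename_X]
  exact hn

/-- The condition is stable under sums, so homogeneous elements suffice. -/
theorem exists_pow_smul_mem_range_augR [Module.Free ℤ N] (hX : X.IsProjective) {f : X.S' k}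
    (hf : f ∈ (X.irr' k).radical) (m : (X.pushS k).carrier) :
    ∃ n : ℕ, f ^ n • m ∈ LinearMap.range (X.augR k) := by
  have hadd : ∀ x y : (X.pushS k).carrier, (∃ n : ℕ, f ^ n • x ∈ LinearMap.range (X.augR k)) →
      (∃ n : ℕ, f ^ n • y ∈ LinearMap.range (X.augR k)) →
      ∃ n : ℕ, f ^ n • (x + y) ∈ LinearMap.range (X.augR k) := by
    rintro x y ⟨n, hx⟩ ⟨m, hy⟩
    refine ⟨n + m, ?_⟩
    rw [smul_add]
    refine add_mem ?_ ?_
    · rw [add_comm, pow_add, mul_smul]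
      exact Submodule.smul_mem _ _ hx
    · rw [pow_add, mul_smul]
      exact Submodule.smul_mem _ _ hy
  have hof : ∀ (a : X.Cl × X.Cl) (s : (GrMod.self (X.grS k)).piece ((X.diagonal k).deg a)),
      ∃ n : ℕ, f ^ n • (show (X.pushS k).carrier from
        (X.diagonal k).pushOf (GrMod.self (X.grS k)) a s) ∈ LinearMap.range (X.augR k) := by
    intro a s
    have h := Ideal.radical_mono (X.irr'_le_radical k hX a s.1 s.2) hf
    rw [Ideal.radical_idem] at h
    exact h
  have hzero : ∃ n : ℕ, f ^ n • (0 : (X.pushS k).carrier) ∈ LinearMap.range (X.augR k) :=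
    ⟨0, by rw [smul_zero]; exact zero_mem _⟩
  exact (X.diagonal k).push_induction (GrMod.self (X.grS k)) m hzero hof hadd

/-- The homomorphism `F_0 → ⨁_{(a, b)} S_{a + b}`. -/
def augF : (X.koszulF k 0).Hom (X.pushS k) where
  toLin := X.augR k ∘ₗ LinearMap.proj (R := X.S' k)
    (φ := fun _ : {s : Finset (Fin r) // s.card = 0} => X.R k) ⟨∅, rfl⟩
  map_mem {a v} hv := by
    refine X.augR_mem k ?_
    have h := hv ⟨∅, rfl⟩
    rwa [Finset.sum_empty, sub_zero] at h

theorem koszulD_zero_apply (v : Koszul (X.R k) r 1) :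
    koszulD (X.koszulElt k) 0 v ⟨∅, rfl⟩ =
      ∑ i, v ⟨{i}, Finset.card_singleton i⟩ * X.koszulElt k i := by
  rw [koszulD_eq_koszulSum _ _ _ _ (koszulExt_apply v), koszulSum, Finset.sdiff_empty]
  refine Finset.sum_congr rfl fun i _ => ?_
  rw [insert_empty_eq, koszulExt_apply v ⟨{i}, Finset.card_singleton i⟩, Finset.filter_empty,
    Finset.card_empty, pow_zero, one_mul, mul_comm]

theorem ker_augF : LinearMap.ker (X.augF k).toLin = LinearMap.range (X.koszulFD k 0).toLin := by
  ext z
  change Koszul (X.R k) r 0 at z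
  change X.augR k (z ⟨∅, rfl⟩) = 0 ↔ ∃ v, koszulD (X.koszulElt k) 0 v = z
  rw [augR_eq_zero_iff, Ideal.mem_span_range_iff_exists_fun]
  constructor
  · rintro ⟨c, hc⟩
    -- On a singleton `{i}` this sum is just `c i`.
    refine ⟨fun s => ∑ i ∈ s.1, c i, funext fun ⟨s, hs⟩ => ?_⟩
    obtain rfl := Finset.card_eq_zero.1 hs
    rw [koszulD_zero_apply, ← hc]
    simp
  · rintro ⟨v, rfl⟩
    exact ⟨_, (X.koszulD_zero_apply k v).symm⟩

theorem nonempty_iso_sheafODelta [Module.Free ℤ N] (hX : X.IsProjective) :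
    Nonempty (QCoh.Iso (sheafify (X.irr' k) (X.koszulH0 k)) (X.sheafODelta k)) := by
  refine nonempty_iso_pushforward (X.diagonal k) (GrMod.self (X.grS k))
    (GrMod.cokerLift (X.koszulFD k 0) (X.augF k) (X.ker_augF k).ge) ?_ fun f hf m => ?_
  · refine LinearMap.ker_eq_bot.1 ?_
    exact Submodule.ker_liftQ_eq_bot _ _ _ (X.ker_augF k).le
  · obtain ⟨n, z, hz⟩ := X.exists_pow_smul_mem_range_augR k hX hf m
    -- `F_0` has the single index `∅`, so an element of `R` is a constant function.
    exact ⟨n, (LinearMap.range (X.koszulFD k 0).toLin).mkQ (fun _ => z), hz⟩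

end Diagonal

end Fan
end ToricStack

end

/-! ### The resolution of the diagonal. -/

theorem theorem4p1 {k : Type*} [Field k] {N : Type*} [AddCommGroup N] [Module.Free ℤ N]
    [Module.Finite ℤ N] {r : ℕ} (X : ToricStack.Fan N r) (hX : X.IsProjective) :
    -- `F` is acyclic: `H_{p+1}(F) = 0` for all `p ≥ 0`
    (∀ p : ℕ, Function.Exact (ToricStack.koszulD (X.koszulElt k) (p + 1))
      (ToricStack.koszulD (X.koszulElt k) p)) ∧
    -- `H_0(F)` sheafifies to `𝒪_Δ`
    Nonempty (ToricStack.QCoh.Iso (ToricStack.sheafify (X.irr' k) (X.koszulH0 k))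
      (X.sheafODelta k)) ∧
    -- the sheafification of `F` is a resolution of `𝒪_Δ`
    (∃ ε : ToricStack.QCoh.Hom (ToricStack.sheafify (X.irr' k) (X.koszulF k 0)) (X.sheafODelta k),
      ToricStack.QCoh.Epi ε ∧
      ToricStack.QCoh.Exact (ToricStack.sheafifyMap (X.irr' k) (X.koszulFD k 0)) ε ∧
      ∀ p : ℕ, ToricStack.QCoh.Exact (ToricStack.sheafifyMap (X.irr' k) (X.koszulFD k (p + 1)))
        (ToricStack.sheafifyMap (X.irr' k) (X.koszulFD k p))) := by
  obtain ⟨e⟩ := X.nonempty_iso_sheafODelta k hX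
  refine ⟨X.koszulElt_exact k, ⟨e⟩,
    e.hom.comp (ToricStack.sheafifyMap (X.irr' k) (ToricStack.GrMod.cokerMk (X.koszulFD k 0))),
    fun U => ?_, fun U => ?_,
    fun p => ToricStack.sheafifyMap_exact _ _ _ (X.koszulElt_exact k p)⟩
  · exact (Function.RightInverse.surjective (e.inv_hom U)).comp
      (ToricStack.sheafifyMap_epi (X.irr' k) (ToricStack.GrMod.cokerMk (X.koszulFD k 0))
        (Submodule.mkQ_surjective _) U)
  -- Exactness at `F_0` holds for the projection to the cokernel, and following it by an injective
  -- map does not change the kernel.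
  · exact (ToricStack.sheafifyMap_exact (X.irr' k) (X.koszulFD k 0)
      (ToricStack.GrMod.cokerMk (X.koszulFD k 0))
      (LinearMap.exact_map_mkQ_range _) U).comp_injective _
        (Function.LeftInverse.injective (e.hom_inv U)) (map_zero (e.hom.app U).toLin)
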